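/- **Setting.** There are $N$ players; player $i$ has a closed, compact, convex strategy set $X_i\subseteq\mathbb R^{n_i}$, $X=\prod_i X_i$, and minimizes over $x_i\in X_i$ the cost $f_i(x_i,x_{-i})=\mathbb E[\psi_i(x_i,x_{-i};\xi)]$, where $\xi$ is a random vector in $\mathbb R^d$. Norms are Euclidean (spectral for matrices). Assume for every $i$: for each $x_{-i}\in X_{-i}$, $f_i(\cdot,x_{-i})$ is convex and twice continuously differentiable on an open set containing $X_i$; for each $x_{-i}\in X_{-i}$ and $\omega$, $\psi_i(\cdot,x_{-i};\xi(\omega))$ is differentiable on an open set containing $X_i$; on $X$, $\nabla_{x_i}f_i(x)=\mathbb E[\nabla_{x_i}\psi_i(x;\xi)]$ and $\mathbb E\|\nabla_{x_i}\psi_i(x;\xi)\|^2\le M_i^2$ with a constant $M_i>0$; and the mixed derivatives $\nabla^2_{x_ix_j}f_i$, $j\ne i$, exist and are bounded on $X$. Fix $\mu>0$, put $\zeta_{i,\min}=\inf_{x\in X}\lambda_{\min}(\nabla^2_{x_i}f_i(x))$ and $\zeta_{ij,\max}=\sup_{x\in X}\|\nabla^2_{x_ix_j}f_i(x)\|$,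 let $\Gamma$ be the $N\times N$ matrix with $\Gamma_{ii}=\frac{\mu}{\mu+\zeta_{i,\min}}$ and $\Gamma_{ij}=\frac{\zeta_{ij,\max}}{\mu+\zeta_{i,\min}}$ for $j\neq i$, and assume $a:=\|\Gamma\|<1$. Let $x^*$ be a Nash equilibrium, and let $\widehat x_i(y)=\operatorname{argmin}_{x_i\in X_i}\big[f_i(x_i,y_{-i})+\frac\mu2\|x_i-y_i\|^2\big]$ be the proximal best response. A random profile $x$ is an $\epsilon$-NE$_2$ if $\mathbb E\big[\big(\sum_i\|x_i-x_i^*\|^2\big)^{1/2}\big]\le\epsilon$. **Algorithm.** Let $\eta\in(0,1)$, $Q_i=\frac{2M_i^2}{\mu^2}+2\,\mathrm{diam}(X_i)^2$, $j_{i,k}=\lceil Q_i/\eta^{2(k+1)}\rceil$. Start from a (possibly random) $x_0\in X$. At major iteration $k=0,1,\dots$ every player $i$ sets $z_{i,1}=x_{i,k}$ and, with $\gamma_t=\frac1{\mu(t+1)}$ and samples $\xi_{i,k}^t$, $$z_{i,t+1}=\Pi_{X_i}\big[z_{i,t}-\gamma_t\big(\nabla_{x_i}\psi_i(z_{i,t},x_{-i,k};\xi_{i,k}^t)+\mu(z_{i,t}-x_{i,k})\big)\big],$$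 and then $x_{i,k+1}=z_{i,j_{i,k}}$; this is counted as $j_{i,k}$ projected stochastic gradient steps of player $i$. Let $\mathcal F_k$ be generated by $x_0$ and the samples $\xi_{i,l}^t$, $1\le t\le j_{i,l}$, of all players at iterations $l<k$. For $1\le t\le j_{i,k}$ assume that the sampled gradient $\nabla_{x_i}\psi_i(z_{i,t},x_{-i,k};\xi^t_{i,k})$ is square integrable and that, conditionally on $\mathcal F_k$ and $\xi_{i,k}^1,\dots,\xi_{i,k}^{t-1}$, it has mean $\nabla_{x_i}f_i(z_{i,t},x_{-i,k})$ and second moment at most $\mathbb E_\xi\|\nabla_{x_i}\psi_i(z,x_{-i,k};\xi)\|^2$ at $z=z_{i,t}$ (as is the case if $\xi_{i,k}^t$ is distributed as $\xi$ and independent of the past). Let $C$ satisfy $\mathbb E\big[\big(\sum_i\|x_{i,0}-x_i^*\|^2\big)^{1/2}\big]\le\sqrt N\,C$ (for deterministic $x_0$ this holds if $\|x_{i,0}-x_i^*\|\le C$ for all $i$). **Theorem.** The iterates satisfy $x_{i,k+1}\in X_i$ and $\mathbb E[\|x_{i,k+1}-\widehat x_i(x_k)\|^2\mid\mathcal F_k]\le\alpha_{i,k}^2$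 a.s. with $\alpha_{i,k}=\eta^{k+1}$, for all $i$ and $k$. For $q\in(c,1)$ with $c=\max\{a,\eta\}$, and $D=1/\ln((q/c)^e)$, let $$\ell_i(\eta)=\frac{Q_i}{\eta^4\ln(1/\eta^2)}\Big(\frac{\sqrt N(C+D)}{\epsilon}\Big)^{\frac{\ln(1/\eta^2)}{\ln(1/q)}}+\Big\lceil\frac{\ln(\sqrt N(C+D)/\epsilon)}{\ln(1/q)}\Big\rceil,$$ where $\lceil s\rceil$ is read as $0$ for $s<0$. (a) For every $\epsilon>0$ there is a $K$ such that $x_K$ is an $\epsilon$-NE$_2$ and, for every player $i$, the number $\sum_{k<K}j_{i,k}$ of projected stochastic gradient steps of player $i$ up to that point is at most $\ell_i(\eta)$. (b) $\ell_i(\eta)=\Omega(1/\epsilon^2)$ as $\epsilon\downarrow0$ (all other quantities fixed). For every $\delta>0$ there is a $q\in(a,1)$ for which, with $\eta=a$ (so $c=a$), $D=\frac{1+2\delta^{-1}}{e\ln(a^{-1})}$ and, for all $\epsilon>0$, $$\ell_i(a)\le\frac{Q_i}{a^4\ln(1/a^2)}\Big(\frac{\sqrt N(C+D)}{\epsilon}\Big)^{2+\delta}+\Big\lceil\ln\Big(\frac{\sqrt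 N(C+D)}{\epsilon}\Big)\frac{2+\delta}{2\ln(a^{-1})}\Big\rceil;$$ hence $\ell_i(a)=O\big((\sqrt N/\epsilon)^{2+\delta}\big)$ for $\epsilon\in(0,1]$ and $N\ge1$, with a constant that depends only on $Q_i,a,C,\delta$ (the expression $\ell_i(a)$ being regarded as a function of $N$ and $\epsilon$). -/

import Mathlib

open MeasureTheory Filter Topology Set
open scoped Asymptotics

noncomputable section

namespace SNash

/-- The strategy space `ℝ^{n_i}` of player `i`. -/
abbrev Strat {N : ℕ} (n : Fin N → ℕ) (i : Fin N) : Type := EuclideanSpace ℝ (Fin (n i))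

/-- Strategy profiles `x = (x_1, …, x_N)`. -/
abbrev Profile {N : ℕ} (n : Fin N → ℕ) : Type := ∀ i : Fin N, Strat n i

/-- Values of the random vector `ξ`. -/
abbrev Noise (d : ℕ) : Type := EuclideanSpace ℝ (Fin d)

/-- A minimizer of `g` over `S` (an arbitrary point if there is none). -/
def argminOn {E : Type*} [Nonempty E] (S : Set E) (g : E → ℝ) : E :=
  Classical.epsilon fun p => p ∈ S ∧ ∀ w ∈ S, g p ≤ g w

/-- Euclidean projection onto `S`: the nearest point of `S`. -/
def proj {m : ℕ} (S : Set (EuclideanSpace ℝ (Fin m))) (u : EuclideanSpace ℝ (Fin m)) :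
    EuclideanSpace ℝ (Fin m) :=
  argminOn S fun w => ‖u - w‖

/-- The smallest (real) eigenvalue of a linear operator. -/
def lamMin {m : ℕ} (A : EuclideanSpace ℝ (Fin m) →L[ℝ] EuclideanSpace ℝ (Fin m)) : ℝ :=
  sInf {t : ℝ | Module.End.HasEigenvalue
    (A : EuclideanSpace ℝ (Fin m) →ₗ[ℝ] EuclideanSpace ℝ (Fin m)) t}

section Calculus

variable {N : ℕ} {n : Fin N → ℕ}

/-- The partial gradient `∇_{x_i} g (x)`. -/
def pgrad (i : Fin N) (g : Profile n → ℝ) (x : Profile n) : Strat n i :=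
  gradient (fun u : Strat n i => g (Function.update x i u)) (x i)

/-- The block `∇²_{x_i x_j} g (x)` of the Hessian: the derivative in `x_j` of `∇_{x_i} g`. -/
def hessBlock (i j : Fin N) (g : Profile n → ℝ) (x : Profile n) : Strat n j →L[ℝ] Strat n i :=
  fderiv ℝ (fun u : Strat n j => pgrad i g (Function.update x j u)) (x j)

/-- The Euclidean norm of the vector `(‖x_1 - x'_1‖, …, ‖x_N - x'_N‖)`. -/
def pdist (x x' : Profile n) : ℝ := √(∑ i, ‖x i - x' i‖ ^ 2)

end Calculus

/-- The data of an `N`-player stochastic Nash game: the strategy sets `X_i ⊆ ℝ^{n_i}`, the functions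
`ψ_i(x; ξ)`, the probability `P` on `Ω` and the random vector `ξ : Ω → ℝ^d`.  Functions are total;
all regularity below is asked for only on, or on a neighbourhood of, the strategy sets. -/
structure Game (N d : ℕ) (n : Fin N → ℕ) (Ω : Type*) [MeasurableSpace Ω] where
  P : Measure Ω
  X : ∀ i : Fin N, Set (Strat n i)
  ψ : Fin N → Profile n → Noise d → ℝ
  ξ : Ω → Noise d

namespace Game

variable {N d : ℕ} {n : Fin N → ℕ} {Ω : Type*} [MeasurableSpace Ω] (G : Game N d n Ω)

/-- `X = ∏ X_i`. -/
def feasible : Set (Profile n) := {x | ∀ i, x i ∈ G.X i}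

/-- `f_i(x) = 𝔼[ψ_i(x; ξ)]`. -/
def f (i : Fin N) (x : Profile n) : ℝ := ∫ ω, G.ψ i x (G.ξ ω) ∂G.P

/-- The sampled partial gradient `∇_{x_i} ψ_i(x; s)`. -/
def oracle (i : Fin N) (x : Profile n) (s : Noise d) : Strat n i :=
  pgrad i (fun y => G.ψ i y s) x

/-- `x` is a Nash equilibrium. -/
def IsNash (x : Profile n) : Prop :=
  x ∈ G.feasible ∧ ∀ i, ∀ u ∈ G.X i, G.f i x ≤ G.f i (Function.update x i u)

/-- The standing regularity assumptions on the game, with second-moment constants `M_i`. -/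
structure Regular (M : Fin N → ℝ) : Prop where
  prob : IsProbabilityMeasure G.P
  meas_ξ : Measurable G.ξ
  /-- joint measurability of the stochastic first-order oracle on `X × ℝ^d` -/
  meas_oracle : ∀ i, Measurable fun p : G.feasible × Noise d => G.oracle i p.1 p.2
  compact : ∀ i, IsCompact (G.X i)
  closed : ∀ i, IsClosed (G.X i)
  convex : ∀ i, Convex ℝ (G.X i)
  /-- for fixed rivals' strategies, `f_i` is a (finite) expectation which is convex and `C²` in `x_i`
  on an open set containing `X_i` -/
  smooth : ∀ i, ∀ x ∈ G.feasible, ∃ U : Set (Strat n i), IsOpen U ∧ G.X i ⊆ U ∧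
    (∀ u ∈ U, Integrable (fun ω => G.ψ i (Function.update x i u) (G.ξ ω)) G.P) ∧
    ConvexOn ℝ U (fun u => G.f i (Function.update x i u)) ∧
    ContDiffOn ℝ 2 (fun u => G.f i (Function.update x i u)) U
  /-- the mixed derivatives `∇²_{x_i x_j} f_i` exist on `X` and are bounded there, which is what makes
  the numbers `ζ_{ij,max}` well defined -/
  mixed : ∀ i j, i ≠ j →
    (∀ x ∈ G.feasible, DifferentiableAt ℝ
      (fun u : Strat n j => pgrad i (G.f i) (Function.update x j u)) (x j)) ∧
    BddAbove (range fun x : G.feasible => ‖hessBlock i j (G.f i) (x : Profile n)‖)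
  /-- `ψ_i(·, x_{-i}; ξ(ω))` is differentiable on an open set containing `X_i` -/
  diff_ψ : ∀ i, ∀ x ∈ G.feasible, ∀ ω, ∃ U : Set (Strat n i), IsOpen U ∧ G.X i ⊆ U ∧
    DifferentiableOn ℝ (fun u => G.ψ i (Function.update x i u) (G.ξ ω)) U
  /-- `∇_{x_i} f_i(x) = 𝔼[∇_{x_i} ψ_i(x; ξ)]` -/
  unbiased : ∀ i, ∀ x ∈ G.feasible, Integrable (fun ω => G.oracle i x (G.ξ ω)) G.P ∧
    pgrad i (G.f i) x = ∫ ω, G.oracle i x (G.ξ ω) ∂G.P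
  M_pos : ∀ i, 0 < M i
  /-- `𝔼[‖∇_{x_i} ψ_i(x; ξ)‖²] ≤ M_i²` on `X` -/
  second_moment : ∀ i, ∀ x ∈ G.feasible,
    Integrable (fun ω => ‖G.oracle i x (G.ξ ω)‖ ^ 2) G.P ∧
    ∫ ω, ‖G.oracle i x (G.ξ ω)‖ ^ 2 ∂G.P ≤ M i ^ 2

/-- `ζ_{i,min} = inf_{x ∈ X} λ_min(∇²_{x_i} f_i(x))`. -/
def ζmin (i : Fin N) : ℝ := ⨅ x : G.feasible, lamMin (hessBlock i i (G.f i) (x : Profile n))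

/-- `ζ_{ij,max} = sup_{x ∈ X} ‖∇²_{x_i x_j} f_i(x)‖` (spectral norm). -/
def ζmax (i j : Fin N) : ℝ := ⨆ x : G.feasible, ‖hessBlock i j (G.f i) (x : Profile n)‖

/-- The matrix `Γ`. -/
def Γ (μ : ℝ) : Matrix (Fin N) (Fin N) ℝ := Matrix.of fun i j =>
  if i = j then μ / (μ + G.ζmin i) else G.ζmax i j / (μ + G.ζmin i)

/-- `a = ‖Γ‖`, the spectral norm of `Γ`. -/
def a (μ : ℝ) : ℝ := ‖Matrix.toEuclideanCLM (𝕜 := ℝ) (G.Γ μ)‖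

/-- The proximal best response `x̂_i(y)`. -/
def proxBR (μ : ℝ) (i : Fin N) (y : Profile n) : Strat n i :=
  argminOn (G.X i) fun u => G.f i (Function.update y i u) + μ / 2 * ‖u - y i‖ ^ 2

/-- `Q_i = 2 M_i² / μ² + 2 D_{X_i}²`, where `D_{X_i}` is the diameter of `X_i`. -/
def Q (M : Fin N → ℝ) (μ : ℝ) (i : Fin N) : ℝ :=
  2 * M i ^ 2 / μ ^ 2 + 2 * Metric.diam (G.X i) ^ 2

/-- The number `j_{i,k} = ⌈Q_i / η^{2(k+1)}⌉` of stochastic gradient steps which player `i` takes at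
major iteration `k`. -/
def innerSteps (M : Fin N → ℝ) (μ η : ℝ) (i : Fin N) (k : ℕ) : ℕ :=
  ⌈G.Q M μ i / η ^ (2 * (k + 1))⌉₊

/-- The inner iterates `z_{i,t}` (`t ≥ 1`; the value at `t = 0` is not used) of player `i`, started
at `z_{i,1} = y_i`, for the samples `s 1, s 2, …`:
`z_{i,t+1} = Π_{X_i}[z_{i,t} - γ_t (∇_{x_i} ψ_i(z_{i,t}, y_{-i}; s t) + μ (z_{i,t} - y_i))]`
with `γ_t = 1 / (μ (t + 1))`. -/
def inner (μ : ℝ) (i : Fin N) (y : Profile n) (s : ℕ → Noise d) : ℕ → Strat n i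
  | 0 => y i
  | 1 => y i
  | t + 2 =>
    let z := inner μ i y s (t + 1)
    proj (G.X i) (z - (1 / (μ * (((t + 1 : ℕ) : ℝ) + 1))) •
      (G.oracle i (Function.update y i z) (s (t + 1)) + μ • (z - y i)))

/-- The iterates `x_k` of the synchronous scheme, as a function of the initial profile and of all the
samples `s i k t` (player `i`, major iteration `k`, inner step `t ≥ 1`):
all players set `x_{i,k+1} = z_{i,j_{i,k}}`, where the inner iterates are computed with `y = x_k`. -/
def outer (M : Fin N → ℝ) (μ η : ℝ) (x₀ : Profile n) (s : Fin N → ℕ → ℕ → Noise d) :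
    ℕ → Profile n
  | 0 => x₀
  | k + 1 => fun i =>
    G.inner μ i (outer M μ η x₀ s k) (s i k) (G.innerSteps M μ η i k)

section Run

variable (M : Fin N → ℝ) (μ η : ℝ) (x₀ : Ω → Profile n) (S : Fin N → ℕ → ℕ → Ω → Noise d)

/-- The random iterate `x_k`. -/
def iter (k : ℕ) (ω : Ω) : Profile n := G.outer M μ η (x₀ ω) (fun i l t => S i l t ω) k

/-- The profile `(z_{i,t}, y_{-i,k})` at which player `i` calls the oracle in step `t` of major
iteration `k`. -/
def query (i : Fin N) (k t : ℕ) (ω : Ω) : Profile n :=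
  Function.update (G.iter M μ η x₀ S k ω) i
    (G.inner μ i (G.iter M μ η x₀ S k ω) (fun l => S i k l ω) t)

/-- `ℱ_k = σ(x_0, ξ_{i,l} : i, l < k)` with `ξ_{i,l} = (ξ_{i,l}^1, …, ξ_{i,l}^{j_{i,l}})`. -/
def sigmaF (k : ℕ) : MeasurableSpace Ω :=
  MeasurableSpace.comap x₀ inferInstance ⊔
    ⨆ (i : Fin N) (l ∈ Finset.range k) (t ∈ Finset.Icc 1 (G.innerSteps M μ η i l)),
      MeasurableSpace.comap (S i l t) inferInstance

/-- `σ(ℱ_k, ξ_{i,k}^1, …, ξ_{i,k}^{t-1})`. -/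
def sigmaFin (i : Fin N) (k t : ℕ) : MeasurableSpace Ω :=
  G.sigmaF M μ η x₀ S k ⊔
    ⨆ s ∈ Finset.Ico 1 t, MeasurableSpace.comap (S i k s) inferInstance

/-- The sampling assumption: conditionally on the past, the sampled gradient at the current query
point is an unbiased estimate of the true partial gradient, and its second moment is at most that of
`∇_{x_i} ψ_i(x; ξ)` at this point.  Both hold if `ξ_{i,k}^t` is distributed as `ξ` and independent
of the past. -/
structure Sampling : Prop where
  meas_x₀ : Measurable x₀
  meas_S : ∀ i k t, Measurable (S i k t)
  integrable : ∀ i k, ∀ t ∈ Finset.Icc 1 (G.innerSteps M μ η i k),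
    Integrable (fun ω => G.oracle i (G.query M μ η x₀ S i k t ω) (S i k t ω)) G.P ∧
    Integrable (fun ω => ‖G.oracle i (G.query M μ η x₀ S i k t ω) (S i k t ω)‖ ^ 2) G.P
  cond_mean : ∀ i k, ∀ t ∈ Finset.Icc 1 (G.innerSteps M μ η i k),
    G.P[fun ω => G.oracle i (G.query M μ η x₀ S i k t ω) (S i k t ω) |
        G.sigmaFin M μ η x₀ S i k t]
      =ᵐ[G.P] fun ω => pgrad i (G.f i) (G.query M μ η x₀ S i k t ω)
  cond_second_moment : ∀ i k, ∀ t ∈ Finset.Icc 1 (G.innerSteps M μ η i k),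
    G.P[fun ω => ‖G.oracle i (G.query M μ η x₀ S i k t ω) (S i k t ω)‖ ^ 2 |
        G.sigmaFin M μ η x₀ S i k t]
      ≤ᵐ[G.P] fun ω =>
        ∫ ω', ‖G.oracle i (G.query M μ η x₀ S i k t ω) (G.ξ ω')‖ ^ 2 ∂G.P

end Run

/-- The random profile `x` is an `ε`-NE₂ with respect to the equilibrium `xs`. -/
def IsEpsNE2 (xs : Profile n) (ε : ℝ) (x : Ω → Profile n) : Prop :=
  Integrable (fun ω => pdist (x ω) xs) G.P ∧ ∫ ω, pdist (x ω) xs ∂G.P ≤ ε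

end Game

/-- `D = 1 / ln((q/c)^e)`. -/
def Dconst (c q : ℝ) : ℝ := 1 / Real.log ((q / c) ^ Real.exp 1)

/-- The complexity bound `ℓ(η)`; the rounded-up logarithm counts as `0` when it is negative. -/
def ell (Q η : ℝ) (N : ℕ) (C D q ε : ℝ) : ℝ :=
  Q / (η ^ 4 * Real.log (1 / η ^ 2)) *
      (√N * (C + D) / ε) ^ (Real.log (1 / η ^ 2) / Real.log (1 / q)) +
    (⌈Real.log (√N * (C + D) / ε) / Real.log (1 / q)⌉₊ : ℝ)

end SNash

end

/-! ### Convex calculus, smallest eigenvalues, minimizers and projections. -/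

noncomputable section

namespace SNash

open scoped RealInnerProductSpace

/-! The scheme is an inexact fixed-point iteration for the proximal best response, and the proof
combines a contraction, a stochastic gradient rate and a count.

Contraction. The proximal objective of player `i` is strongly convex with constant `μ + ζ_i`.
Comparing the variational inequalities of two best responses gives `‖x̂_i(y) - x̂_i(y')‖ ≤ ∑ j, Γ_ij
‖y_j - y'_j‖` (`norm_proxBR_sub_le`): the diagonal of `Γ` comes from the proximal term, the rest
from the mixed derivatives. Since the equilibrium is a fixed point (`proxBR_nash`), one exact step
shrinks the distance to it by the factor `a`.

Inner accuracy. Conditionally on the past, one projected step with `γ_t = 1 / (μ (t + 1))` turns a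
mean square error `A` into at most `(1 - 2 / (t + 1)) A + Q / (t + 1)²`, so by induction the error
of `z_{i,t}` is at most `Q / t` (`condExp_inner_le`). Thus `j_{i,k}` is just large enough for
accuracy `η^(k+1)`.

Outer rate. The triangle inequality through the exact best response gives `e_{k+1} ≤ √N η^(k+1) + a
e_k` for the mean distance `e_k`, whence `e_k ≤ √N c^k (C + k)`. The factor `k` is absorbed by
passing from `c` to `q`, since `k c^k ≤ D q^k` (`natCast_mul_pow_le`). So `K = ⌈ln(√N (C + D) / ε) /
ln(1/q)⌉` iterations suffice, and the geometric sum of the `j_{i,k}` is `ℓ_i(η)` at most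
(`sum_ceil_le`).

Part (b) concerns the expression `ℓ_i` alone: its exponent is at least 2 because `η < q`, and equals
`2 + δ` for `η = a`, `q = a^(2/(2+δ))`. -/

theorem hasDerivAt_comp_lineMap {E F : Type*} [NormedAddCommGroup E]
    [NormedSpace ℝ E] [NormedAddCommGroup F] [NormedSpace ℝ F]
    {φ : E → F} {φ' : E →L[ℝ] F} {x y : E} {t : ℝ}
    (h : HasFDerivAt φ φ' (AffineMap.lineMap x y t)) :
    HasDerivAt (fun s : ℝ => φ (AffineMap.lineMap x y s)) (φ' (y - x)) t :=
  h.comp_hasDerivAt t AffineMap.hasDerivAt_lineMap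

/-- A vector field whose derivative is bounded below by `c` along a segment is strongly monotone. -/
theorem inner_sub_ge_of_fderiv {E : Type*} [NormedAddCommGroup E] [InnerProductSpace ℝ E]
    {S : Set E} (hS : Convex ℝ S) {F : E → E} {c : ℝ}
    (hF : ∀ x ∈ S, DifferentiableAt ℝ F x)
    (hc : ∀ x ∈ S, ∀ w, c * ‖w‖ ^ 2 ≤ ⟪fderiv ℝ F x w, w⟫) {u v : E} (hu : u ∈ S) (hv : v ∈ S) :
    c * ‖u - v‖ ^ 2 ≤ ⟪F u - F v, u - v⟫ := by
  have hmem : ∀ t ∈ Icc (0 : ℝ) 1, (AffineMap.lineMap v u : ℝ →ᵃ[ℝ] E) t ∈ S := fun t ht =>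
    hS.lineMap_mem hv hu ht
  have hder : ∀ t ∈ Icc (0 : ℝ) 1,
      HasDerivAt (fun t : ℝ => ⟪F (AffineMap.lineMap v u t), u - v⟫)
        ⟪fderiv ℝ F (AffineMap.lineMap v u t) (u - v), u - v⟫ t := by
    intro t ht
    have h := hasDerivAt_comp_lineMap (hF _ (hmem t ht)).hasFDerivAt
    simpa using h.inner ℝ (hasDerivAt_const t (u - v))
  have h := (convex_Icc (0 : ℝ) 1).mul_sub_le_image_sub_of_le_deriv (C := c * ‖u - v‖ ^ 2)
    (fun t ht => (hder t ht).continuousAt.continuousWithinAt)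
    (fun t ht => (hder t (interior_subset ht)).differentiableAt.differentiableWithinAt)
    (fun t ht => by
      rw [(hder t (interior_subset ht)).deriv]
      exact hc _ (hmem t (interior_subset ht)) _)
    0 (by simp) 1 (by simp) zero_le_one
  simpa [inner_sub_left] using h

section Gradient

variable {E : Type*} [NormedAddCommGroup E] [InnerProductSpace ℝ E] [CompleteSpace E]

/-- The Riesz identification of the dual of a real Hilbert space, as a linear map. -/
def riesz (E : Type*) [NormedAddCommGroup E] [InnerProductSpace ℝ E] [CompleteSpace E] :
    StrongDual ℝ E →L[ℝ] E :=
  LinearMap.mkContinuous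
    { toFun := (InnerProductSpace.toDual ℝ E).symm
      map_add' := fun x y => map_add _ x y
      map_smul' := fun c x => by simp } 1 (fun x => by simp)

theorem gradient_eq_riesz (φ : E → ℝ) (x : E) : gradient φ x = riesz E (fderiv ℝ φ x) := rfl

theorem inner_riesz (l : StrongDual ℝ E) (w : E) : ⟪riesz E l, w⟫ = l w :=
  InnerProductSpace.toDual_symm_apply

/-- The first-order characterization of convexity. -/
theorem inner_gradient_le_of_convexOn {U : Set E} {φ : E → ℝ} (hφ : ConvexOn ℝ U φ)
    {x y : E} (hx : x ∈ U) (hy : y ∈ U) (hd : DifferentiableAt ℝ φ x) :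
    ⟪gradient φ x, y - x⟫ ≤ φ y - φ x := by
  have hg : ConvexOn ℝ ((AffineMap.lineMap x y : ℝ →ᵃ[ℝ] E) ⁻¹' U)
      (φ ∘ (AffineMap.lineMap x y : ℝ →ᵃ[ℝ] E)) := hφ.comp_affineMap _
  have h := hg.le_slope_of_hasDerivAt (x := 0) (y := 1) (by simpa) (by simpa) one_pos
    (hasDerivAt_comp_lineMap (φ := φ) (φ' := fderiv ℝ φ x) (by simpa using hd.hasFDerivAt))
  rw [gradient_eq_riesz, inner_riesz]
  simpa [slope_def_field] using h

theorem inner_gradient_sub_nonneg_of_convexOn {U : Set E} {φ : E → ℝ} (hφ : ConvexOn ℝ U φ)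
    {x y : E} (hx : x ∈ U) (hy : y ∈ U) (hdx : DifferentiableAt ℝ φ x)
    (hdy : DifferentiableAt ℝ φ y) :
    0 ≤ ⟪gradient φ x - gradient φ y, x - y⟫ := by
  have h1 := inner_gradient_le_of_convexOn hφ hx hy hdx
  have h2 := inner_gradient_le_of_convexOn hφ hy hx hdy
  rw [inner_sub_left]
  have : ⟪gradient φ x, x - y⟫ = -⟪gradient φ x, y - x⟫ := by rw [← inner_neg_right, neg_sub]
  linarith

/-- The first-order optimality condition on a convex set. -/
theorem inner_gradient_nonneg_of_isMinOn {S : Set E} (hS : Convex ℝ S) {φ : E → ℝ} {p w : E}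
    (hp : p ∈ S) (hw : w ∈ S) (hd : DifferentiableAt ℝ φ p) (hmin : IsMinOn φ S p) :
    0 ≤ ⟪gradient φ p, w - p⟫ := by
  rw [gradient_eq_riesz, inner_riesz]
  exact hmin.localize.hasFDerivWithinAt_nonneg hd.hasFDerivAt.hasFDerivWithinAt
    (sub_mem_posTangentConeAt_of_segment_subset (hS.segment_subset hp hw))

theorem hasFDerivAt_gradient {U : Set E} (hU : IsOpen U) {φ : E → ℝ} (hφ : ContDiffOn ℝ 2 φ U)
    {x : E} (hx : x ∈ U) :
    HasFDerivAt (gradient φ) ((riesz E).comp (fderiv ℝ (fderiv ℝ φ) x)) x := by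
  have h1 : ContDiffAt ℝ 2 φ x := hφ.contDiffAt (hU.mem_nhds hx)
  have h2 : DifferentiableAt ℝ (fderiv ℝ φ) x :=
    (h1.fderiv_right (m := 1) (by norm_num)).differentiableAt one_ne_zero
  exact (riesz E).hasFDerivAt.comp x h2.hasFDerivAt

/-- Symmetry of second derivatives; it is needed to bound the quadratic form of the Hessian below by
its smallest eigenvalue. -/
theorem isSymmetric_fderiv_gradient {U : Set E} (hU : IsOpen U) {φ : E → ℝ}
    (hφ : ContDiffOn ℝ 2 φ U) {x : E} (hx : x ∈ U) :
    (fderiv ℝ (gradient φ) x : E →ₗ[ℝ] E).IsSymmetric := by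
  intro v w
  have h1 : ContDiffAt ℝ 2 φ x := hφ.contDiffAt (hU.mem_nhds hx)
  have hs : IsSymmSndFDerivAt ℝ φ x := h1.isSymmSndFDerivAt (by simp)
  rw [(hasFDerivAt_gradient hU hφ hx).fderiv, real_inner_comm]
  simp only [ContinuousLinearMap.coe_coe, ContinuousLinearMap.comp_apply]
  rw [real_inner_comm, inner_riesz, real_inner_comm, inner_riesz]
  exact hs v w

/-- The quadratic form is the limit, as `t ↓ 0`, of `⟪∇φ(x + t w) - ∇φ(x), w⟫ / t`, which is
nonnegative because the gradient of a convex function is monotone. -/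
theorem inner_fderiv_gradient_nonneg {U : Set E} (hU : IsOpen U) {φ : E → ℝ}
    (hφ : ContDiffOn ℝ 2 φ U) (hc : ConvexOn ℝ U φ) {x : E} (hx : x ∈ U) (w : E) :
    0 ≤ ⟪fderiv ℝ (gradient φ) x w, w⟫ := by
  have hd : ∀ y ∈ U, DifferentiableAt ℝ φ y := fun y hy =>
    (hφ.contDiffAt (hU.mem_nhds hy)).differentiableAt two_ne_zero
  have hF := (hasFDerivAt_gradient hU hφ hx).differentiableAt.hasFDerivAt
  have h1 : HasDerivAt (fun t : ℝ => ⟪gradient φ (AffineMap.lineMap x (x + w) t), w⟫)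
      ⟪fderiv ℝ (gradient φ) x w, w⟫ 0 := by
    have h := hasDerivAt_comp_lineMap (x := x) (y := x + w) (t := 0)
      (φ := gradient φ) (φ' := fderiv ℝ (gradient φ) x) (by simpa using hF)
    simpa using h.inner ℝ (hasDerivAt_const (0 : ℝ) w)
  have h2 := h1.tendsto_slope_zero_right
  refine ge_of_tendsto h2 ?_
  have hU' : ∀ᶠ t : ℝ in 𝓝[>] 0, x + t • w ∈ U := by
    have : Tendsto (fun t : ℝ => x + t • w) (𝓝 0) (𝓝 x) := by
      have : Continuous (fun t : ℝ => x + t • w) := by fun_prop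
      simpa using this.tendsto 0
    exact (this.eventually (hU.mem_nhds hx)).filter_mono nhdsWithin_le_nhds
  filter_upwards [hU', self_mem_nhdsWithin] with t ht htpos
  have htpos : 0 < t := htpos
  have h3 := inner_gradient_sub_nonneg_of_convexOn hc ht hx (hd _ ht) (hd _ hx)
  rw [add_sub_cancel_left, inner_smul_right] at h3
  have h4 : 0 ≤ ⟪gradient φ (x + t • w) - gradient φ x, w⟫ := nonneg_of_mul_nonneg_right h3 htpos
  rw [inner_sub_left] at h4
  have e : (AffineMap.lineMap x (x + w) : ℝ →ᵃ[ℝ] E) t = x + t • w := by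
    simp [AffineMap.lineMap_apply, add_comm]
  simp only [zero_add, AffineMap.lineMap_apply_zero, e, smul_eq_mul]
  positivity

end Gradient

section LamMin

variable {m : ℕ}

theorem nonneg_of_hasEigenvalue {A : EuclideanSpace ℝ (Fin m) →L[ℝ] EuclideanSpace ℝ (Fin m)}
    (hA : ∀ w, 0 ≤ ⟪A w, w⟫) {t : ℝ} (ht : Module.End.HasEigenvalue
      (A : EuclideanSpace ℝ (Fin m) →ₗ[ℝ] EuclideanSpace ℝ (Fin m)) t) : 0 ≤ t := by
  obtain ⟨v, hv⟩ := Module.End.HasEigenvalue.exists_hasEigenvector ht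
  have h1 : A v = t • v := hv.apply_eq_smul
  have h2 := hA v
  rw [h1, inner_smul_left, real_inner_self_eq_norm_sq] at h2
  have h3 : 0 < ‖v‖ := norm_pos_iff.2 hv.2
  exact nonneg_of_mul_nonneg_left (by simpa using h2) (by positivity)

theorem lamMin_nonneg {A : EuclideanSpace ℝ (Fin m) →L[ℝ] EuclideanSpace ℝ (Fin m)}
    (hA : ∀ w, 0 ≤ ⟪A w, w⟫) : 0 ≤ lamMin A :=
  Real.sInf_nonneg fun _ ht => nonneg_of_hasEigenvalue hA ht

/-- In finite dimension the infimum of the Rayleigh quotient of a symmetric operator is itself an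
eigenvalue, so `lamMin A` does not exceed it. -/
theorem lamMin_mul_sq_le {A : EuclideanSpace ℝ (Fin m) →L[ℝ] EuclideanSpace ℝ (Fin m)}
    (hA : ∀ w, 0 ≤ ⟪A w, w⟫)
    (hs : (A : EuclideanSpace ℝ (Fin m) →ₗ[ℝ] EuclideanSpace ℝ (Fin m)).IsSymmetric)
    (w : EuclideanSpace ℝ (Fin m)) : lamMin A * ‖w‖ ^ 2 ≤ ⟪A w, w⟫ := by
  rcases eq_or_ne w 0 with rfl | hw
  · simp
  have : Nontrivial (EuclideanSpace ℝ (Fin m)) := ⟨w, 0, hw⟩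
  have hE := hs.hasEigenvalue_iInf_of_finiteDimensional
  have hb : BddBelow {t : ℝ | Module.End.HasEigenvalue
      (A : EuclideanSpace ℝ (Fin m) →ₗ[ℝ] EuclideanSpace ℝ (Fin m)) t} :=
    ⟨0, fun _ ht => nonneg_of_hasEigenvalue hA ht⟩
  have h1 := csInf_le hb hE
  have h2 : (⨅ x : { x : EuclideanSpace ℝ (Fin m) // x ≠ 0 },
      RCLike.re ⟪A x, x⟫ / ‖(x : EuclideanSpace ℝ (Fin m))‖ ^ 2 : ℝ) ≤ ⟪A w, w⟫ / ‖w‖ ^ 2 := by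
    refine ciInf_le (f := fun x : { x : EuclideanSpace ℝ (Fin m) // x ≠ 0 } =>
      ⟪A x, x⟫ / ‖(x : EuclideanSpace ℝ (Fin m))‖ ^ 2) ⟨0, ?_⟩ ⟨w, hw⟩
    rintro _ ⟨x, rfl⟩
    have := hA x
    positivity
  have h3 : 0 < ‖w‖ := norm_pos_iff.2 hw
  rw [← le_div_iff₀ (by positivity)]
  exact h1.trans h2

end LamMin

section Argmin

theorem argminOn_spec {E : Type*} [TopologicalSpace E] [Nonempty E] {S : Set E}
    (hS : IsCompact S) (hne : S.Nonempty) {g : E → ℝ} (hg : ContinuousOn g S) :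
    argminOn S g ∈ S ∧ IsMinOn g S (argminOn S g) := by
  obtain ⟨p, hp, hmin⟩ := hS.exists_isMinOn hne hg
  exact Classical.epsilon_spec (p := fun p => p ∈ S ∧ ∀ w ∈ S, g p ≤ g w) ⟨p, hp, hmin⟩

variable {m : ℕ} {S : Set (EuclideanSpace ℝ (Fin m))}

theorem proj_spec (hS : IsCompact S) (hne : S.Nonempty) (u : EuclideanSpace ℝ (Fin m)) :
    proj S u ∈ S ∧ IsMinOn (fun w => ‖u - w‖) S (proj S u) :=
  argminOn_spec hS hne (by fun_prop)

theorem inner_proj_le (hS : IsCompact S) (hne : S.Nonempty) (hc : Convex ℝ S)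
    (u : EuclideanSpace ℝ (Fin m)) {w : EuclideanSpace ℝ (Fin m)} (hw : w ∈ S) :
    ⟪u - proj S u, w - proj S u⟫ ≤ 0 := by
  obtain ⟨h1, h2⟩ := proj_spec hS hne u
  refine (norm_eq_iInf_iff_real_inner_le_zero hc h1).1 ?_ w hw
  have : Nonempty S := hne.to_subtype
  refine le_antisymm (le_ciInf fun x => h2 x.2) ?_
  exact ciInf_le (f := fun x : S => ‖u - x‖) ⟨0, by rintro _ ⟨x, rfl⟩; positivity⟩ ⟨_, h1⟩

/-- Adding the obtuse-angle inequalities at the two projections gives `‖p - q‖² ≤ ⟪u - v, p - q⟫`;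
Cauchy–Schwarz does the rest. -/
theorem norm_proj_sub_proj_le (hS : IsCompact S) (hne : S.Nonempty) (hc : Convex ℝ S)
    (u v : EuclideanSpace ℝ (Fin m)) : ‖proj S u - proj S v‖ ≤ ‖u - v‖ := by
  have h1 := inner_proj_le hS hne hc u (proj_spec hS hne v).1
  have h2 := inner_proj_le hS hne hc v (proj_spec hS hne u).1
  set p := proj S u
  set q := proj S v
  have h3 : ⟪u - v, p - q⟫ = ‖p - q‖ ^ 2 - ⟪u - p, q - p⟫ - ⟪v - q, p - q⟫ := by
    rw [← real_inner_self_eq_norm_sq]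
    simp only [inner_sub_left, inner_sub_right]
    ring
  have h4 := real_inner_le_norm (u - v) (p - q)
  by_contra! h
  have := norm_nonneg (u - v)
  nlinarith

theorem proj_eq_self (hS : IsCompact S) {u : EuclideanSpace ℝ (Fin m)} (hu : u ∈ S) :
    proj S u = u := by
  have h := (proj_spec hS ⟨u, hu⟩ u).2 hu
  have h' : ‖u - proj S u‖ ≤ 0 := by simpa using h
  exact (sub_eq_zero.1 (norm_le_zero_iff.1 h')).symm

theorem continuous_proj (hS : IsCompact S) (hne : S.Nonempty) (hc : Convex ℝ S) :
    Continuous (proj S) :=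
  (LipschitzWith.of_dist_le_mul (K := 1) fun u v => by
    simpa [dist_eq_norm] using norm_proj_sub_proj_le hS hne hc u v).continuous

end Argmin

end SNash

end

/-! ### The proximal best response and its contraction property. -/

noncomputable section

namespace SNash

open scoped RealInnerProductSpace
open Function (update)

section Calculus

variable {N : ℕ} {n : Fin N → ℕ}

theorem pgrad_update (i : Fin N) (g : Profile n → ℝ) (x : Profile n) (u : Strat n i) :
    pgrad i g (update x i u) = gradient (fun v => g (update x i v)) u := by
  simp [pgrad]

theorem hessBlock_update (i : Fin N) (g : Profile n → ℝ) (x : Profile n) (u : Strat n i) :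
    hessBlock i i g (update x i u) = fderiv ℝ (gradient fun v => g (update x i v)) u := by
  simp only [hessBlock, Function.update_self, Function.update_idem, pgrad_update]

theorem pdist_eq_norm (x x' : Profile n) :
    pdist x x' = ‖(WithLp.toLp 2 fun i => ‖x i - x' i‖ : EuclideanSpace ℝ (Fin N))‖ := by
  simp [pdist, EuclideanSpace.norm_eq]

theorem pdist_nonneg (x x' : Profile n) : 0 ≤ pdist x x' := Real.sqrt_nonneg _

theorem pdist_le_of_norm_sub_le {x x' : Profile n} {v : EuclideanSpace ℝ (Fin N)}
    (h : ∀ i, ‖x i - x' i‖ ≤ v i) : pdist x x' ≤ ‖v‖ := by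
  rw [EuclideanSpace.norm_eq]
  refine Real.sqrt_le_sqrt (Finset.sum_le_sum fun i _ => ?_)
  rw [Real.norm_eq_abs, sq_abs]
  exact pow_le_pow_left₀ (norm_nonneg _) (h i) 2

theorem pdist_triangle (x y z : Profile n) : pdist x z ≤ pdist x y + pdist y z := by
  rw [pdist_eq_norm x y, pdist_eq_norm y z]
  refine (pdist_le_of_norm_sub_le fun i => ?_).trans (norm_add_le _ _)
  simpa using norm_sub_le_norm_sub_add_norm_sub (x i) (y i) (z i)

end Calculus

namespace Game

variable {N d : ℕ} {n : Fin N → ℕ} {Ω : Type*} [MeasurableSpace Ω] {G : Game N d n Ω}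
  {M : Fin N → ℝ}

theorem update_mem_feasible {x : Profile n} (hx : x ∈ G.feasible) {i : Fin N} {u : Strat n i}
    (hu : u ∈ G.X i) : update x i u ∈ G.feasible := by
  intro j
  rcases eq_or_ne j i with rfl | h
  · simpa
  · simpa [h] using hx j

theorem Regular.hessian_nonneg (hG : G.Regular M) (i : Fin N) {x : Profile n}
    (hx : x ∈ G.feasible) (w : Strat n i) : 0 ≤ ⟪hessBlock i i (G.f i) x w, w⟫ := by
  obtain ⟨U, hU, hXU, -, hc, hs⟩ := hG.smooth i x hx
  rw [← Function.update_eq_self i x, hessBlock_update]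
  exact inner_fderiv_gradient_nonneg hU hs hc (hXU (hx i)) w

theorem Regular.hessian_isSymmetric (hG : G.Regular M) (i : Fin N) {x : Profile n}
    (hx : x ∈ G.feasible) :
    (hessBlock i i (G.f i) x : Strat n i →ₗ[ℝ] Strat n i).IsSymmetric := by
  obtain ⟨U, hU, hXU, -, hc, hs⟩ := hG.smooth i x hx
  rw [← Function.update_eq_self i x, hessBlock_update]
  exact isSymmetric_fderiv_gradient hU hs (hXU (hx i))

theorem Regular.ζmin_nonneg (hG : G.Regular M) (i : Fin N) : 0 ≤ G.ζmin i :=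
  Real.iInf_nonneg fun x => lamMin_nonneg fun w => hG.hessian_nonneg i x.2 w

theorem Regular.ζmin_mul_sq_le (hG : G.Regular M) (i : Fin N) {x : Profile n}
    (hx : x ∈ G.feasible) (w : Strat n i) :
    G.ζmin i * ‖w‖ ^ 2 ≤ ⟪hessBlock i i (G.f i) x w, w⟫ := by
  have h : G.ζmin i ≤ lamMin (hessBlock i i (G.f i) x) :=
    ciInf_le (f := fun x : G.feasible => lamMin (hessBlock i i (G.f i) (x : Profile n)))
      ⟨0, by
        rintro _ ⟨y, rfl⟩
        exact lamMin_nonneg fun w => hG.hessian_nonneg i y.2 w⟩ ⟨x, hx⟩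
  exact (mul_le_mul_of_nonneg_right h (sq_nonneg _)).trans
    (lamMin_mul_sq_le (hG.hessian_nonneg i hx) (hG.hessian_isSymmetric i hx) w)

theorem Regular.norm_hessBlock_le (hG : G.Regular M) {i j : Fin N} (hij : i ≠ j) {x : Profile n}
    (hx : x ∈ G.feasible) : ‖hessBlock i j (G.f i) x‖ ≤ G.ζmax i j :=
  le_ciSup (f := fun x : G.feasible => ‖hessBlock i j (G.f i) (x : Profile n)‖)
    (hG.mixed i j hij).2 ⟨x, hx⟩

theorem Regular.differentiableAt_f (hG : G.Regular M) (i : Fin N) {x : Profile n}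
    (hx : x ∈ G.feasible) {u : Strat n i} (hu : u ∈ G.X i) :
    DifferentiableAt ℝ (fun v => G.f i (update x i v)) u := by
  obtain ⟨U, hU, hXU, -, hc, hs⟩ := hG.smooth i x hx
  exact (hs.contDiffAt (hU.mem_nhds (hXU hu))).differentiableAt two_ne_zero

/-- Strong monotonicity of the partial gradient in the player's own variable. -/
theorem Regular.inner_pgrad_sub_ge (hG : G.Regular M) (i : Fin N) {x : Profile n}
    (hx : x ∈ G.feasible) {u v : Strat n i} (hu : u ∈ G.X i) (hv : v ∈ G.X i) :
    G.ζmin i * ‖u - v‖ ^ 2 ≤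
      ⟪pgrad i (G.f i) (update x i u) - pgrad i (G.f i) (update x i v), u - v⟫ := by
  obtain ⟨U, hU, hXU, -, hc, hs⟩ := hG.smooth i x hx
  rw [pgrad_update, pgrad_update]
  refine inner_sub_ge_of_fderiv (hG.convex i)
    (fun w hw => (hasFDerivAt_gradient hU hs (hXU hw)).differentiableAt) (fun y hy w => ?_) hu hv
  rw [← hessBlock_update]
  exact hG.ζmin_mul_sq_le i (update_mem_feasible hx hy) w

theorem Regular.norm_pgrad_update_sub_le (hG : G.Regular M) {i j : Fin N} (hij : i ≠ j)
    {x : Profile n} (hx : x ∈ G.feasible) {u v : Strat n j} (hu : u ∈ G.X j) (hv : v ∈ G.X j) :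
    ‖pgrad i (G.f i) (update x j u) - pgrad i (G.f i) (update x j v)‖ ≤
      G.ζmax i j * ‖u - v‖ := by
  refine (hG.convex j).norm_image_sub_le_of_norm_fderiv_le
    (𝕜 := ℝ) (f := fun w => pgrad i (G.f i) (update x j w)) (fun w hw => ?_) (fun w hw => ?_) hv hu
  · simpa using (hG.mixed i j hij).1 _ (update_mem_feasible hx hw)
  · simpa [hessBlock] using hG.norm_hessBlock_le hij (update_mem_feasible hx hw)

/-- The rivals' coordinates are exchanged one at a time, each at the cost given by the mean value
inequality. All intermediate profiles stay feasible since `X` is a product. -/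
theorem Regular.norm_pgrad_piecewise_sub_le (hG : G.Regular M) (i : Fin N) {y y' : Profile n}
    (hy : y ∈ G.feasible) (hy' : y' ∈ G.feasible) (s : Finset (Fin N)) (hi : i ∉ s) :
    ‖pgrad i (G.f i) (s.piecewise y y') - pgrad i (G.f i) y'‖ ≤
      ∑ j ∈ s, G.ζmax i j * ‖y j - y' j‖ := by
  induction s using Finset.induction_on with
  | empty => simp
  | insert j s hj ih =>
    rw [Finset.mem_insert, not_or] at hi
    have hmem : s.piecewise y y' ∈ G.feasible := fun l => by
      by_cases hl : l ∈ s
      · rw [Finset.piecewise_eq_of_mem _ _ _ hl]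
        exact hy l
      · rw [Finset.piecewise_eq_of_notMem _ _ _ hl]
        exact hy' l
    have h1 := hG.norm_pgrad_update_sub_le hi.1 hmem (hy j) (hy' j)
    have h2 : update (s.piecewise y y') j (y' j) = s.piecewise y y' := by
      rw [← Finset.piecewise_eq_of_notMem s y y' hj, Function.update_eq_self]
    rw [h2] at h1
    rw [Finset.piecewise_insert, Finset.sum_insert hj]
    exact (norm_sub_le_norm_sub_add_norm_sub _ (pgrad i (G.f i) (s.piecewise y y')) _).trans
      (add_le_add h1 (ih hi.2))

/-- Lipschitz dependence of the partial gradient on the rivals' strategies. -/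
theorem Regular.norm_pgrad_sub_le (hG : G.Regular M) (i : Fin N) {y y' : Profile n}
    (hy : y ∈ G.feasible) (hy' : y' ∈ G.feasible) (h : y i = y' i) :
    ‖pgrad i (G.f i) y - pgrad i (G.f i) y'‖ ≤
      ∑ j ∈ Finset.univ.erase i, G.ζmax i j * ‖y j - y' j‖ := by
  have h1 : (Finset.univ.erase i).piecewise y y' = y := by
    funext j
    by_cases hj : j = i
    · rw [hj, Finset.piecewise_eq_of_notMem _ _ _ (Finset.notMem_erase i _), h]
    · exact Finset.piecewise_eq_of_mem _ _ _ (Finset.mem_erase.2 ⟨hj, Finset.mem_univ j⟩)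
  have h2 := hG.norm_pgrad_piecewise_sub_le i hy hy' _ (Finset.notMem_erase i Finset.univ)
  rwa [h1] at h2

theorem Regular.proxBR_spec (hG : G.Regular M) (μ : ℝ) (i : Fin N) {y : Profile n}
    (hy : y ∈ G.feasible) :
    G.proxBR μ i y ∈ G.X i ∧
      IsMinOn (fun u => G.f i (update y i u) + μ / 2 * ‖u - y i‖ ^ 2) (G.X i) (G.proxBR μ i y) := by
  refine argminOn_spec (hG.compact i) ⟨_, hy i⟩ fun u hu => ?_
  have h := (hG.differentiableAt_f i hy hu).continuousAt
  exact (h.add (by fun_prop)).continuousWithinAt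

theorem Regular.proxBR_mem (hG : G.Regular M) (μ : ℝ) (i : Fin N) {y : Profile n}
    (hy : y ∈ G.feasible) : G.proxBR μ i y ∈ G.X i := (hG.proxBR_spec μ i hy).1

/-- The variational inequality which characterizes the proximal best response. -/
theorem Regular.inner_proxBR_nonneg (hG : G.Regular M) (μ : ℝ) (i : Fin N) {y : Profile n}
    (hy : y ∈ G.feasible) {w : Strat n i} (hw : w ∈ G.X i) :
    0 ≤ ⟪pgrad i (G.f i) (update y i (G.proxBR μ i y)) + μ • (G.proxBR μ i y - y i),
      w - G.proxBR μ i y⟫ := by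
  obtain ⟨hp, hmin⟩ := hG.proxBR_spec μ i hy
  set p := G.proxBR μ i y
  have h1 := (hG.differentiableAt_f i hy hp).hasFDerivAt
  have h2 : HasFDerivAt (fun u : Strat n i => ‖u - y i‖ ^ 2)
      (2 • (innerSL ℝ (p - y i)).comp (ContinuousLinearMap.id ℝ _)) p :=
    ((hasFDerivAt_id p).sub_const (y i)).norm_sq
  have h3 := h1.add (h2.const_mul (μ / 2))
  have h4 := inner_gradient_nonneg_of_isMinOn (hG.convex i) hp hw h3.differentiableAt hmin
  rw [gradient_eq_riesz, inner_riesz] at h4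
  have h5 : fderiv ℝ (fun u => G.f i (update y i u) + μ / 2 * ‖u - y i‖ ^ 2) p (w - p) =
      fderiv ℝ (fun u => G.f i (update y i u)) p (w - p) + μ * ⟪p - y i, w - p⟫ := by
    refine (congrArg (fun l => l (w - p)) h3.fderiv).trans ?_
    simp [inner_sub_left]
    ring
  rw [inner_add_left, pgrad_update, gradient_eq_riesz, inner_riesz, inner_smul_left]
  simpa using h4.trans_eq h5

theorem Regular.inner_pgrad_nash_nonneg (hG : G.Regular M) {xs : Profile n} (hxs : G.IsNash xs)
    (i : Fin N) {w : Strat n i} (hw : w ∈ G.X i) : 0 ≤ ⟪pgrad i (G.f i) xs, w - xs i⟫ := by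
  refine inner_gradient_nonneg_of_isMinOn (hG.convex i) (hxs.1 i) hw
    (hG.differentiableAt_f i hxs.1 (hxs.1 i)) fun u hu => ?_
  simpa using hxs.2 i u hu

/-- Strong monotonicity of the proximal gradient relative to the proximal best response. -/
theorem Regular.inner_prox_gradient_ge (hG : G.Regular M) (μ : ℝ) (i : Fin N) {y : Profile n}
    (hy : y ∈ G.feasible) {z : Strat n i} (hz : z ∈ G.X i) :
    (μ + G.ζmin i) * ‖z - G.proxBR μ i y‖ ^ 2 ≤
      ⟪pgrad i (G.f i) (update y i z) + μ • (z - y i), z - G.proxBR μ i y⟫ := by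
  have h1 := hG.inner_proxBR_nonneg μ i hy hz
  have h2 := hG.inner_pgrad_sub_ge i hy hz (hG.proxBR_mem μ i hy)
  set p := G.proxBR μ i y
  -- The first two summands supply `ζ_i` and `μ`; the last is the proximal gradient at `p`, whose
  -- pairing with `z - p` is nonnegative by optimality.
  have e : pgrad i (G.f i) (update y i z) + μ • (z - y i) =
      (pgrad i (G.f i) (update y i z) - pgrad i (G.f i) (update y i p)) + μ • (z - p) +
      (pgrad i (G.f i) (update y i p) + μ • (p - y i)) := by module
  rw [e, inner_add_left, inner_add_left (_ - _), inner_smul_left, real_inner_self_eq_norm_sq]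
  simp only [conj_trivial]
  linarith

/-- At `z = xs i` the proximal term has zero gradient, so the equilibrium condition and strong
monotonicity leave no room between `xs i` and the best response. -/
theorem Regular.proxBR_nash (hG : G.Regular M) {μ : ℝ} (hμ : 0 < μ) {xs : Profile n}
    (hxs : G.IsNash xs) (i : Fin N) : G.proxBR μ i xs = xs i := by
  have h1 := hG.inner_prox_gradient_ge μ i hxs.1 (hxs.1 i)
  have h2 := hG.inner_pgrad_nash_nonneg hxs i (hG.proxBR_mem μ i hxs.1)
  have hζ := hG.ζmin_nonneg i
  rw [Function.update_eq_self, sub_self, smul_zero, add_zero, ← neg_sub (G.proxBR μ i xs),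
    inner_neg_right, norm_neg] at h1
  have h3 : (μ + G.ζmin i) * ‖G.proxBR μ i xs - xs i‖ ^ 2 ≤ 0 := by linarith
  have h4 : ‖G.proxBR μ i xs - xs i‖ ^ 2 ≤ 0 := nonpos_of_mul_nonpos_right h3 (by linarith)
  have h5 : ‖G.proxBR μ i xs - xs i‖ = 0 := pow_eq_zero_iff two_ne_zero |>.1
    (le_antisymm h4 (sq_nonneg _))
  exact sub_eq_zero.1 (norm_eq_zero.1 h5)

theorem Regular.norm_proxBR_sub_le (hG : G.Regular M) {μ : ℝ} (hμ : 0 < μ) (i : Fin N)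
    {y y' : Profile n} (hy : y ∈ G.feasible) (hy' : y' ∈ G.feasible) :
    ‖G.proxBR μ i y - G.proxBR μ i y'‖ ≤ ∑ j, G.Γ μ i j * ‖y j - y' j‖ := by
  have hp := hG.proxBR_mem μ i hy
  have hp' := hG.proxBR_mem μ i hy'
  have h1 := hG.inner_prox_gradient_ge μ i hy hp'
  have h2 := hG.inner_proxBR_nonneg μ i hy' hp
  have h3 := hG.norm_pgrad_sub_le i (update_mem_feasible hy hp')
    (update_mem_feasible hy' hp') (by simp)
  have hζ := hG.ζmin_nonneg i
  set p := G.proxBR μ i y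
  set p' := G.proxBR μ i y'
  have h3' : ‖pgrad i (G.f i) (update y i p') - pgrad i (G.f i) (update y' i p')‖ ≤
      ∑ j ∈ Finset.univ.erase i, G.ζmax i j * ‖y j - y' j‖ := by
    refine h3.trans_eq (Finset.sum_congr rfl fun j hj => ?_)
    have hj := Finset.ne_of_mem_erase hj
    simp [hj]
  set R := ∑ j ∈ Finset.univ.erase i, G.ζmax i j * ‖y j - y' j‖
  have hpos : 0 < μ + G.ζmin i := by linarith
  have e : ∑ j, G.Γ μ i j * ‖y j - y' j‖ = (μ * ‖y i - y' i‖ + R) / (μ + G.ζmin i) := by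
    rw [← Finset.add_sum_erase _ _ (Finset.mem_univ i), add_div, Finset.sum_div]
    congr 1
    · simp [Γ]; ring
    · refine Finset.sum_congr rfl fun j hj => ?_
      have hj := (Finset.ne_of_mem_erase hj).symm
      simp [Γ, hj]; ring
  rw [e, le_div_iff₀ hpos, norm_sub_rev, mul_comm]
  -- Strong monotonicity for `y` is tested at `p'` and optimality for `y'` at `p`. Both remaining
  -- gradients have own strategy `p'`, so only the rivals' strategies differ.
  have h4 : (μ + G.ζmin i) * ‖p' - p‖ ^ 2 ≤
      ⟪pgrad i (G.f i) (update y i p') - pgrad i (G.f i) (update y' i p') - μ • (y i - y' i),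
        p' - p⟫ := by
    have e' : pgrad i (G.f i) (update y i p') + μ • (p' - y i) =
      (pgrad i (G.f i) (update y i p') - pgrad i (G.f i) (update y' i p') - μ • (y i - y' i)) +
      (pgrad i (G.f i) (update y' i p') + μ • (p' - y' i)) := by module
    rw [e', inner_add_left] at h1
    rw [← neg_sub p' p, inner_neg_right] at h2
    linarith
  have h5 : ‖pgrad i (G.f i) (update y i p') - pgrad i (G.f i) (update y' i p')
      - μ • (y i - y' i)‖ ≤ R + μ * ‖y i - y' i‖ := by
    refine (norm_sub_le _ _).trans (add_le_add h3' ?_)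
    rw [norm_smul, Real.norm_of_nonneg hμ.le]
  have h6 := h4.trans ((real_inner_le_norm _ _).trans
    (mul_le_mul_of_nonneg_right h5 (norm_nonneg _)))
  rcases (norm_nonneg (p' - p)).eq_or_lt with h0 | h0
  · rw [← h0, mul_zero]
    have := norm_nonneg (y i - y' i)
    have hR : 0 ≤ R := (norm_nonneg _).trans h3'
    positivity
  · rw [pow_two, ← mul_assoc] at h6
    linarith [le_of_mul_le_mul_right h6 h0]

theorem norm_Γ_apply_le (μ : ℝ) (v : EuclideanSpace ℝ (Fin N)) :
    ‖(WithLp.toLp 2 fun i => ∑ j, G.Γ μ i j * v j : EuclideanSpace ℝ (Fin N))‖ ≤ G.a μ * ‖v‖ :=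
  (Matrix.toEuclideanCLM (𝕜 := ℝ) (G.Γ μ)).le_opNorm v

/-- The proximal best response map contracts towards the equilibrium. -/
theorem Regular.pdist_proxBR_le (hG : G.Regular M) {μ : ℝ} (hμ : 0 < μ) {xs y : Profile n}
    (hxs : G.IsNash xs) (hy : y ∈ G.feasible) :
    pdist (fun i => G.proxBR μ i y) xs ≤ G.a μ * pdist y xs := by
  rw [pdist_eq_norm y]
  refine (pdist_le_of_norm_sub_le fun i => ?_).trans (norm_Γ_apply_le μ _)
  simpa [hG.proxBR_nash hμ hxs i] using hG.norm_proxBR_sub_le hμ i hy hxs.1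

theorem Regular.a_pos (hG : G.Regular M) {μ : ℝ} (hμ : 0 < μ) (i : Fin N) : 0 < G.a μ := by
  refine norm_pos_iff.2 fun h => ?_
  have h1 : G.Γ μ = 0 := (map_eq_zero_iff _ (Matrix.toEuclideanCLM (𝕜 := ℝ)).injective).1 h
  have h2 : G.Γ μ i i = 0 := by rw [h1]; rfl
  have hζ := hG.ζmin_nonneg i
  simp only [Γ, Matrix.of_apply, if_true, div_eq_zero_iff] at h2
  rcases h2 with h2 | h2 <;> linarith

theorem Regular.continuousOn_proxBR (hG : G.Regular M) {μ : ℝ} (hμ : 0 < μ) (i : Fin N) :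
    ContinuousOn (G.proxBR μ i) G.feasible := by
  intro y hy
  refine tendsto_iff_norm_sub_tendsto_zero.2 ?_
  have h : Tendsto (fun y' : Profile n => ∑ j, G.Γ μ i j * ‖y' j - y j‖) (𝓝[G.feasible] y)
      (𝓝 0) := by
    have : Continuous fun y' : Profile n => ∑ j, G.Γ μ i j * ‖y' j - y j‖ := by fun_prop
    simpa using (this.tendsto y).mono_left nhdsWithin_le_nhds
  refine squeeze_zero' (Eventually.of_forall fun _ => norm_nonneg _) ?_ h
  filter_upwards [self_mem_nhdsWithin] with y' hy'
  exact hG.norm_proxBR_sub_le hμ i hy' hy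

end Game

end SNash

end

/-! ### Feasibility, measurability and the filtration. -/

noncomputable section

namespace SNash

open scoped RealInnerProductSpace
open Function (update)

namespace Game

variable {N d : ℕ} {n : Fin N → ℕ} {Ω : Type*} [MeasurableSpace Ω] {G : Game N d n Ω}
  {M : Fin N → ℝ}

theorem Regular.inner_mem (hG : G.Regular M) (μ : ℝ) (i : Fin N) {y : Profile n}
    (hy : y ∈ G.feasible) (s : ℕ → Noise d) : ∀ t, G.inner μ i y s t ∈ G.X i
  | 0 => hy i
  | 1 => hy i
  | _ + 2 => (proj_spec (hG.compact i) ⟨_, hy i⟩ _).1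

theorem Regular.outer_mem (hG : G.Regular M) (μ η : ℝ) {x₀ : Profile n} (hx₀ : x₀ ∈ G.feasible)
    (s : Fin N → ℕ → ℕ → Noise d) (k : ℕ) : G.outer M μ η x₀ s k ∈ G.feasible := by
  induction k with
  | zero => exact hx₀
  | succ k ih => exact fun i => hG.inner_mem μ i ih _ _

section Measurability

variable {α : Type*} [MeasurableSpace α]

theorem Regular.measurable_oracle (hG : G.Regular M) (i : Fin N) {y : α → Profile n}
    {s : α → Noise d} (hy : Measurable y) (hyf : ∀ ω, y ω ∈ G.feasible) (hs : Measurable s) :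
    Measurable fun ω => G.oracle i (y ω) (s ω) :=
  (hG.meas_oracle i).comp ((hy.subtype_mk (h := hyf)).prodMk hs)

theorem measurable_update_profile {y : α → Profile n} (hy : Measurable y) {i : Fin N}
    {z : α → Strat n i} (hz : Measurable z) : Measurable fun ω => update (y ω) i (z ω) :=
  measurable_update'.comp (hy.prodMk hz)

/-- Only the samples before step `t` enter. The σ-algebra on `α` is arbitrary so that the lemma
applies to `sigmaF` and `sigmaFin` as well. -/
theorem Regular.measurable_inner (hG : G.Regular M) (μ : ℝ) (i : Fin N) {y : α → Profile n}
    (hy : Measurable y) (hyf : ∀ ω, y ω ∈ G.feasible) {s : ℕ → α → Noise d} :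
    ∀ t, (∀ l ∈ Finset.Ico 1 t, Measurable (s l)) →
      Measurable fun ω => G.inner μ i (y ω) (fun l => s l ω) t
  | 0, _ => (measurable_pi_apply i).comp hy
  | 1, _ => (measurable_pi_apply i).comp hy
  | t + 2, hs => by
    rcases isEmpty_or_nonempty α with h | ⟨⟨ω₀⟩⟩
    · exact measurable_of_empty _
    have hz := hG.measurable_inner μ i hy hyf (s := s) (t + 1) fun l hl =>
      hs l (Finset.Ico_subset_Ico_right (by omega) hl)
    have hyi : Measurable fun ω => y ω i := (measurable_pi_apply i).comp hy
    have ho := hG.measurable_oracle i (measurable_update_profile hy hz)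
      (fun ω => update_mem_feasible (hyf ω) (hG.inner_mem μ i (hyf ω) _ _))
      (hs (t + 1) (by simp))
    have hp := (continuous_proj (hG.compact i) ⟨_, hyf ω₀ i⟩ (hG.convex i)).measurable
    exact hp.comp (hz.sub ((ho.add ((hz.sub hyi).const_smul μ)).const_smul
      (1 / (μ * (((t + 1 : ℕ) : ℝ) + 1)))))

theorem Regular.measurable_proxBR (hG : G.Regular M) {μ : ℝ} (hμ : 0 < μ) (i : Fin N)
    {y : α → Profile n} (hy : Measurable y) (hyf : ∀ ω, y ω ∈ G.feasible) :
    Measurable fun ω => G.proxBR μ i (y ω) :=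
  (continuousOn_iff_continuous_domRestrict.1 (hG.continuousOn_proxBR hμ i)).measurable.comp
    (hy.subtype_mk (h := hyf))

end Measurability

section Run

variable {μ η : ℝ} {x₀ : Ω → Profile n} {S : Fin N → ℕ → ℕ → Ω → Noise d}

theorem sigmaF_mono {k l : ℕ} (h : k ≤ l) : G.sigmaF M μ η x₀ S k ≤ G.sigmaF M μ η x₀ S l :=
  sup_le_sup_left (iSup_mono fun _ => biSup_mono fun _ hj =>
    Finset.range_mono h hj) _

theorem sigmaF_le_sigmaFin (i : Fin N) (k t : ℕ) :
    G.sigmaF M μ η x₀ S k ≤ G.sigmaFin M μ η x₀ S i k t := le_sup_left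

theorem sigmaF_le (hx₀ : Measurable x₀) (hS : ∀ i k t, Measurable (S i k t)) (k : ℕ) :
    G.sigmaF M μ η x₀ S k ≤ ‹MeasurableSpace Ω› :=
  sup_le hx₀.comap_le (iSup_le fun _ => iSup₂_le fun _ _ => iSup₂_le fun _ _ =>
    (hS _ _ _).comap_le)

theorem sigmaFin_le (hx₀ : Measurable x₀) (hS : ∀ i k t, Measurable (S i k t))
    (i : Fin N) (k t : ℕ) : G.sigmaFin M μ η x₀ S i k t ≤ ‹MeasurableSpace Ω› :=
  sup_le (sigmaF_le hx₀ hS k) (iSup₂_le fun _ _ => (hS _ _ _).comap_le)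

theorem measurable_sample_sigmaF {i : Fin N} {l k t : ℕ} (hl : l < k)
    (ht : t ∈ Finset.Icc 1 (G.innerSteps M μ η i l)) :
    Measurable[G.sigmaF M μ η x₀ S k] (S i l t) := by
  refine measurable_iff_comap_le.2 (le_trans ?_ le_sup_right)
  refine le_trans ?_ (le_iSup _ i)
  refine le_trans ?_ (le_iSup₂ l (Finset.mem_range.2 hl))
  exact le_iSup₂ (f := fun t (_ : t ∈ Finset.Icc 1 (G.innerSteps M μ η i l)) =>
    MeasurableSpace.comap (S i l t) inferInstance) t ht

theorem measurable_sample_sigmaFin {i : Fin N} {k t l : ℕ} (hl : l ∈ Finset.Ico 1 t) :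
    Measurable[G.sigmaFin M μ η x₀ S i k t] (S i k l) := by
  refine measurable_iff_comap_le.2 (le_trans ?_ le_sup_right)
  exact le_iSup₂ (f := fun l (_ : l ∈ Finset.Ico 1 t) =>
    MeasurableSpace.comap (S i k l) inferInstance) l hl

theorem Regular.iter_mem (hG : G.Regular M) (hx₀ : ∀ ω, x₀ ω ∈ G.feasible) (k : ℕ) (ω : Ω) :
    G.iter M μ η x₀ S k ω ∈ G.feasible := hG.outer_mem μ η (hx₀ ω) _ k

theorem Regular.measurable_iter_sigmaF (hG : G.Regular M) (hx₀ : ∀ ω, x₀ ω ∈ G.feasible)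
    (k : ℕ) : Measurable[G.sigmaF M μ η x₀ S k] (G.iter M μ η x₀ S k) := by
  induction k with
  | zero => exact measurable_iff_comap_le.2 le_sup_left
  | succ k ih =>
    refine @measurable_pi_lambda _ _ _ (G.sigmaF M μ η x₀ S (k + 1)) _ _ fun i => ?_
    refine @Regular.measurable_inner _ _ _ _ _ G M _ (G.sigmaF M μ η x₀ S (k + 1)) hG μ i
      (G.iter M μ η x₀ S k) (ih.mono (sigmaF_mono (Nat.le_succ k)) le_rfl)
      (hG.iter_mem hx₀ k) (S i k) _ fun l hl => ?_
    -- `z_{i,j}` uses only the samples `1, …, j - 1`, one fewer than `sigmaF` records.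
    exact measurable_sample_sigmaF (Nat.lt_succ_self k) (Finset.Ico_subset_Icc_self hl)

theorem Regular.measurable_inner_sigmaFin (hG : G.Regular M) (hx₀ : ∀ ω, x₀ ω ∈ G.feasible)
    (i : Fin N) (k t : ℕ) : Measurable[G.sigmaFin M μ η x₀ S i k t]
      fun ω => G.inner μ i (G.iter M μ η x₀ S k ω) (fun l => S i k l ω) t :=
  @Regular.measurable_inner _ _ _ _ _ G M _ (G.sigmaFin M μ η x₀ S i k t) hG μ i
    (G.iter M μ η x₀ S k)
    ((hG.measurable_iter_sigmaF hx₀ k).mono (sigmaF_le_sigmaFin i k t) le_rfl)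
    (hG.iter_mem hx₀ k) (S i k) _ fun _ hl => measurable_sample_sigmaFin hl

theorem Regular.measurable_proxBR_sigmaF (hG : G.Regular M) (hμ : 0 < μ)
    (hx₀ : ∀ ω, x₀ ω ∈ G.feasible) (i : Fin N) (k : ℕ) : Measurable[G.sigmaF M μ η x₀ S k]
      fun ω => G.proxBR μ i (G.iter M μ η x₀ S k ω) :=
  @Regular.measurable_proxBR _ _ _ _ _ G M _ (G.sigmaF M μ η x₀ S k) hG μ hμ i
    (G.iter M μ η x₀ S k) (hG.measurable_iter_sigmaF hx₀ k) (hG.iter_mem hx₀ k)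

end Run

end Game

end SNash

end

/-! ### The stochastic gradient rate of the inner loop. -/

noncomputable section

namespace SNash

open scoped RealInnerProductSpace
open Function (update)

/-- One step of a stochastic gradient method with drift `r` and strong monotonicity constant `c`,
conditionally on the past. -/
theorem condExp_norm_sub_smul_sq_le {Ω E : Type*} [NormedAddCommGroup E] [InnerProductSpace ℝ E]
    [CompleteSpace E] {m m₀ : MeasurableSpace Ω} (hm : m ≤ m₀) {P : Measure Ω}
    [IsProbabilityMeasure P] {w r p g : Ω → E} {γ b c R B : ℝ} (hγ : 0 ≤ γ)
    (hw : StronglyMeasurable[m] w) (hr : StronglyMeasurable[m] r)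
    (hwb : ∀ ω, ‖w ω‖ ≤ b) (hrb : ∀ ω, ‖r ω‖ ≤ R) (hg : Integrable g P)
    (hg2 : Integrable (fun ω => ‖g ω‖ ^ 2) P) (hmean : P[g | m] =ᵐ[P] p)
    (hsecond : P[fun ω => ‖g ω‖ ^ 2 | m] ≤ᵐ[P] fun _ => B)
    (hc : ∀ ω, c * ‖w ω‖ ^ 2 ≤ ⟪p ω + r ω, w ω⟫) :
    P[fun ω => ‖w ω - γ • (g ω + r ω)‖ ^ 2 | m] ≤ᵐ[P]
      fun ω => (1 - 2 * γ * c) * ‖w ω‖ ^ 2 + 2 * γ ^ 2 * (B + R ^ 2) := by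
  -- The square is expanded and `‖g + r‖² ≤ 2‖g‖² + 2‖r‖²` applied. `h₀` collects the terms known
  -- from the past; `h₁` is linear in `g`, so its conditional mean involves only `p`.
  set h₀ : Ω → ℝ := fun ω => ‖w ω‖ ^ 2 - 2 * γ * ⟪r ω, w ω⟫ + 2 * γ ^ 2 * ‖r ω‖ ^ 2 with h₀_def
  set h₁ : Ω → ℝ := fun ω => ⟪w ω, g ω⟫ with h₁_def
  have hw₀ := hw.mono hm
  have hr₀ := hr.mono hm
  have hm₀ : StronglyMeasurable[m] h₀ :=
    ((hw.norm.pow 2).sub ((hr.inner hw).const_mul _)).add ((hr.norm.pow 2).const_mul _)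
  have hi₀ : Integrable h₀ P := by
    refine Integrable.of_bound (hm₀.mono hm).aestronglyMeasurable
      (b ^ 2 + 2 * γ * (R * b) + 2 * γ ^ 2 * R ^ 2) (ae_of_all _ fun ω => ?_)
    have hb := hwb ω
    have hR := hrb ω
    have h1 : |⟪r ω, w ω⟫| ≤ R * b := (abs_real_inner_le_norm _ _).trans
      (mul_le_mul hR hb (norm_nonneg _) ((norm_nonneg _).trans hR))
    have h2 : ‖w ω‖ ^ 2 ≤ b ^ 2 := pow_le_pow_left₀ (norm_nonneg _) hb 2
    have h3 : ‖r ω‖ ^ 2 ≤ R ^ 2 := pow_le_pow_left₀ (norm_nonneg _) hR 2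
    refine (norm_add_le _ _).trans (add_le_add ((norm_sub_le _ _).trans (add_le_add ?_ ?_)) ?_)
    · simpa using h2
    · rw [norm_mul, Real.norm_of_nonneg (by positivity)]
      exact mul_le_mul_of_nonneg_left h1 (by positivity)
    · rw [Real.norm_of_nonneg (by positivity)]
      exact mul_le_mul_of_nonneg_left h3 (by positivity)
  have hi₁ : Integrable h₁ P := by
    refine (hg.norm.const_mul b).mono' (hw₀.aestronglyMeasurable.inner hg.aestronglyMeasurable)
      (ae_of_all _ fun ω => ?_)
    exact (norm_inner_le_norm _ _).trans (mul_le_mul_of_nonneg_right (hwb ω) (norm_nonneg _))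
  have e₁ : P[h₁ | m] =ᵐ[P] fun ω => ⟪w ω, p ω⟫ := by
    have h : P[h₁ | m] =ᵐ[P] fun ω => ⟪w ω, P[g | m] ω⟫ :=
      condExp_bilin_of_stronglyMeasurable_left (innerSL ℝ) hw hi₁ hg
    refine h.trans ?_
    filter_upwards [hmean] with ω hω
    rw [hω]
  set H : Ω → ℝ := h₀ + (-(2 * γ)) • h₁ + (2 * γ ^ 2) • fun ω => ‖g ω‖ ^ 2 with H_def
  have hiH : Integrable H P := (hi₀.add (hi₁.smul _)).add (hg2.smul _)
  have hle : ∀ ω, ‖w ω - γ • (g ω + r ω)‖ ^ 2 ≤ H ω := fun ω => by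
    have h1 : ‖w ω - γ • (g ω + r ω)‖ ^ 2 =
        ‖w ω‖ ^ 2 - 2 * γ * (⟪w ω, g ω⟫ + ⟪r ω, w ω⟫) + γ ^ 2 * ‖g ω + r ω‖ ^ 2 := by
      rw [norm_sub_sq_real, inner_smul_right, inner_add_right, norm_smul, mul_pow,
        Real.norm_eq_abs, sq_abs, real_inner_comm (r ω)]
      ring
    have h2 : ‖g ω + r ω‖ ^ 2 ≤ 2 * (‖g ω‖ ^ 2 + ‖r ω‖ ^ 2) :=
      (pow_le_pow_left₀ (norm_nonneg _) (norm_add_le _ _) 2).trans add_sq_le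
    have h3 := mul_le_mul_of_nonneg_left h2 (sq_nonneg γ)
    simp only [H_def, h₀_def, h₁_def, Pi.add_apply, Pi.smul_apply, smul_eq_mul]
    linarith
  have hiL : Integrable (fun ω => ‖w ω - γ • (g ω + r ω)‖ ^ 2) P := by
    refine hiH.mono' ?_ (ae_of_all _ fun ω => ?_)
    · exact ((hw₀.aestronglyMeasurable.sub ((hg.aestronglyMeasurable.add
        hr₀.aestronglyMeasurable).const_smul γ)).norm.pow 2)
    · rw [Real.norm_of_nonneg (by positivity)]
      exact hle ω
  have e₀ : P[h₀ | m] = h₀ := condExp_of_stronglyMeasurable hm hm₀ hi₀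
  filter_upwards [condExp_mono (m := m) hiL hiH (ae_of_all _ hle),
    condExp_add (hi₀.add (hi₁.smul (-(2 * γ)))) (hg2.smul (2 * γ ^ 2)) m,
    condExp_add hi₀ (hi₁.smul (-(2 * γ))) m, condExp_smul (μ := P) (-(2 * γ)) h₁ m,
    condExp_smul (μ := P) (2 * γ ^ 2) (fun ω => ‖g ω‖ ^ 2) m, e₁, hsecond] with
    ω k1 k2 k3 k4 k5 k6 k7
  refine k1.trans ?_
  rw [k2, Pi.add_apply, k3, Pi.add_apply, k4, k5, Pi.smul_apply, Pi.smul_apply, k6, e₀]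
  have h1 := mul_le_mul_of_nonneg_left k7 (by positivity : 0 ≤ 2 * γ ^ 2)
  have h2 := mul_le_mul_of_nonneg_left (hc ω) (by positivity : 0 ≤ 2 * γ)
  have h3 := mul_le_mul_of_nonneg_left (pow_le_pow_left₀ (norm_nonneg _) (hrb ω) 2)
    (by positivity : 0 ≤ 2 * γ ^ 2)
  rw [inner_add_left, real_inner_comm (w ω) (p ω)] at h2
  simp only [h₀_def, smul_eq_mul]
  linarith

/-- The induction step for the rate `Q / t`. The slack is exactly `Q / (t (t + 1)²)`, and `t ≥ 1`
makes the coefficient of `A` nonnegative. -/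
theorem sgd_recursion {Q : ℝ} (hQ : 0 ≤ Q) {t : ℕ} (ht : 1 ≤ t) {A : ℝ} (hA : A ≤ Q / t) :
    (1 - 2 / ((t : ℝ) + 1)) * A + Q / ((t : ℝ) + 1) ^ 2 ≤ Q / ((t : ℝ) + 1) := by
  have ht' : (1 : ℝ) ≤ t := by exact_mod_cast ht
  have h1 : 0 ≤ 1 - 2 / ((t : ℝ) + 1) := by
    rw [sub_nonneg, div_le_one (by linarith)]
    linarith
  refine (add_le_add_left (mul_le_mul_of_nonneg_left hA h1) _).trans ?_
  rw [← sub_nonneg]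
  have e : Q / ((t : ℝ) + 1) - ((1 - 2 / ((t : ℝ) + 1)) * (Q / t) + Q / ((t : ℝ) + 1) ^ 2) =
      Q / (t * ((t : ℝ) + 1) ^ 2) := by
    have : (t : ℝ) ≠ 0 := by linarith
    have : (t : ℝ) + 1 ≠ 0 := by linarith
    field_simp
    ring
  rw [e]
  positivity

namespace Game

variable {N d : ℕ} {n : Fin N → ℕ} {Ω : Type*} [MeasurableSpace Ω] {G : Game N d n Ω}
  {M : Fin N → ℝ} {μ η : ℝ} {x₀ : Ω → Profile n} {S : Fin N → ℕ → ℕ → Ω → Noise d}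

theorem Regular.norm_sub_le_diam (hG : G.Regular M) {i : Fin N} {u v : Strat n i}
    (hu : u ∈ G.X i) (hv : v ∈ G.X i) : ‖u - v‖ ≤ Metric.diam (G.X i) := by
  rw [← dist_eq_norm]
  exact Metric.dist_le_diam_of_mem (hG.compact i).isBounded hu hv

theorem Regular.Q_pos (hG : G.Regular M) (hμ : 0 < μ) (i : Fin N) : 0 < G.Q M μ i := by
  have := hG.M_pos i
  unfold Q
  positivity

/-- The projection fixes the best response and is nonexpansive, so it suffices to bound the
unprojected step. Only the modulus `μ` is kept, `ζ_i ≥ 0` being dropped; the drift is at most `μ ·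
diam`, which accounts for both terms of `Q`. -/
theorem Regular.condExp_inner_succ_le (hG : G.Regular M) (hμ : 0 < μ)
    (hx₀ : ∀ ω, x₀ ω ∈ G.feasible) (hS : G.Sampling M μ η x₀ S) (i : Fin N) (k t : ℕ)
    (ht : t + 1 ∈ Finset.Icc 1 (G.innerSteps M μ η i k)) :
    G.P[fun ω => ‖G.inner μ i (G.iter M μ η x₀ S k ω) (fun l => S i k l ω) (t + 2) -
        G.proxBR μ i (G.iter M μ η x₀ S k ω)‖ ^ 2 | G.sigmaFin M μ η x₀ S i k (t + 1)]
      ≤ᵐ[G.P] fun ω => (1 - 2 / (((t + 1 : ℕ) : ℝ) + 1)) *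
        ‖G.inner μ i (G.iter M μ η x₀ S k ω) (fun l => S i k l ω) (t + 1) -
          G.proxBR μ i (G.iter M μ η x₀ S k ω)‖ ^ 2 +
        G.Q M μ i / (((t + 1 : ℕ) : ℝ) + 1) ^ 2 := by
  have := hG.prob
  have hm : G.sigmaFin M μ η x₀ S i k (t + 1) ≤ ‹MeasurableSpace Ω› :=
    sigmaFin_le hS.meas_x₀ hS.meas_S i k (t + 1)
  have hx := hG.iter_mem (M := M) (μ := μ) (η := η) (S := S) hx₀ k
  set x := G.iter M μ η x₀ S k with x_def
  set z : ℕ → Ω → Strat n i := fun t ω => G.inner μ i (x ω) (fun l => S i k l ω) t with z_def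
  set p : Ω → Strat n i := fun ω => G.proxBR μ i (x ω) with p_def
  set g : Ω → Strat n i :=
    fun ω => G.oracle i (G.query M μ η x₀ S i k (t + 1) ω) (S i k (t + 1) ω) with g_def
  have hzX : ∀ t ω, z t ω ∈ G.X i := fun t ω => hG.inner_mem μ i (hx ω) _ t
  have hpX : ∀ ω, p ω ∈ G.X i := fun ω => hG.proxBR_mem μ i (hx ω)
  have hzm : Measurable[G.sigmaFin M μ η x₀ S i k (t + 1)] (z (t + 1)) :=
    hG.measurable_inner_sigmaFin hx₀ i k (t + 1)
  have hpm : Measurable[G.sigmaFin M μ η x₀ S i k (t + 1)] p :=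
    (hG.measurable_proxBR_sigmaF hμ hx₀ i k).mono (sigmaF_le_sigmaFin i k (t + 1)) le_rfl
  have hxm : Measurable[G.sigmaFin M μ η x₀ S i k (t + 1)] x :=
    (hG.measurable_iter_sigmaF hx₀ k).mono (sigmaF_le_sigmaFin i k (t + 1)) le_rfl
  have hxim : Measurable[G.sigmaFin M μ η x₀ S i k (t + 1)] fun ω => x ω i :=
    (measurable_pi_apply i).comp hxm
  have hw : StronglyMeasurable[G.sigmaFin M μ η x₀ S i k (t + 1)] (z (t + 1) - p) :=
    hzm.stronglyMeasurable.sub hpm.stronglyMeasurable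
  have hr : StronglyMeasurable[G.sigmaFin M μ η x₀ S i k (t + 1)]
      (fun ω => μ • (z (t + 1) ω - x ω i)) :=
    (hzm.stronglyMeasurable.sub hxim.stronglyMeasurable).const_smul μ
  have hsecond : G.P[fun ω => ‖g ω‖ ^ 2 | G.sigmaFin M μ η x₀ S i k (t + 1)] ≤ᵐ[G.P]
      fun _ => M i ^ 2 := by
    filter_upwards [hS.cond_second_moment i k (t + 1) ht] with ω hω
    exact hω.trans (hG.second_moment i _ (update_mem_feasible (hx ω) (hzX _ ω))).2
  have hpos : (0 : ℝ) < ((t + 1 : ℕ) : ℝ) + 1 := by positivity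
  set γ : ℝ := 1 / (μ * (((t + 1 : ℕ) : ℝ) + 1)) with γ_def
  have hγ : 0 ≤ γ := by positivity
  have hstep := condExp_norm_sub_smul_sq_le hm (P := G.P) (c := μ) hγ hw hr
    (fun ω => hG.norm_sub_le_diam (hzX _ ω) (hpX ω))
    (fun ω => by
      rw [norm_smul, Real.norm_of_nonneg hμ.le]
      exact mul_le_mul_of_nonneg_left (hG.norm_sub_le_diam (hzX _ ω) (hx ω i)) hμ.le)
    (hS.integrable i k (t + 1) ht).1 (hS.integrable i k (t + 1) ht).2
    (hS.cond_mean i k (t + 1) ht) hsecond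
    (fun ω => by
      refine le_trans ?_ (hG.inner_prox_gradient_ge μ i (hx ω) (hzX (t + 1) ω))
      have := hG.ζmin_nonneg i
      exact mul_le_mul_of_nonneg_right (by linarith) (sq_nonneg _))
  have hle : ∀ ω, ‖z (t + 2) ω - p ω‖ ^ 2 ≤
      ‖(z (t + 1) - p) ω - γ • (g ω + μ • (z (t + 1) ω - x ω i))‖ ^ 2 := fun ω => by
    refine pow_le_pow_left₀ (norm_nonneg _) ?_ 2
    have h := norm_proj_sub_proj_le (hG.compact i) ⟨_, hx ω i⟩ (hG.convex i)
      (z (t + 1) ω - γ • (g ω + μ • (z (t + 1) ω - x ω i))) (p ω)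
    rw [proj_eq_self (hG.compact i) (hpX ω)] at h
    refine h.trans_eq ?_
    rw [Pi.sub_apply, sub_right_comm]
  have hi : Integrable
      (fun ω => ‖(z (t + 1) - p) ω - γ • (g ω + μ • (z (t + 1) ω - x ω i))‖ ^ 2) G.P := by
    have h1 : MemLp g 2 G.P :=
      (memLp_two_iff_integrable_sq_norm (hS.integrable i k (t + 1) ht).1.aestronglyMeasurable).2
        (hS.integrable i k (t + 1) ht).2
    have h2 : MemLp (z (t + 1) - p) 2 G.P := MemLp.of_bound (hw.mono hm).aestronglyMeasurable _
      (ae_of_all _ fun ω => hG.norm_sub_le_diam (hzX _ ω) (hpX ω))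
    have h3 : MemLp (fun ω => μ • (z (t + 1) ω - x ω i)) 2 G.P :=
      MemLp.of_bound (hr.mono hm).aestronglyMeasurable (μ * Metric.diam (G.X i))
        (ae_of_all _ fun ω => by
          rw [norm_smul, Real.norm_of_nonneg hμ.le]
          exact mul_le_mul_of_nonneg_left (hG.norm_sub_le_diam (hzX _ ω) (hx ω i)) hμ.le)
    exact (h2.sub ((h1.add h3).const_smul γ)).integrable_norm_pow two_ne_zero
  have hiz : Integrable (fun ω => ‖z (t + 2) ω - p ω‖ ^ 2) G.P := by
    refine hi.mono' ?_ (ae_of_all _ fun ω => ?_)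
    · have h1 : Measurable (z (t + 2)) := (hG.measurable_inner_sigmaFin hx₀ i k (t + 2)).mono
        (sigmaFin_le hS.meas_x₀ hS.meas_S i k (t + 2)) le_rfl
      exact ((h1.sub (hpm.mono hm le_rfl)).norm.pow_const 2).aestronglyMeasurable
    · rw [Real.norm_of_nonneg (by positivity)]
      exact hle ω
  filter_upwards [condExp_mono (m := G.sigmaFin M μ η x₀ S i k (t + 1)) hiz hi (ae_of_all _ hle),
    hstep] with ω k1 k2
  refine (k1.trans k2).trans_eq ?_
  have e1 : 2 * γ * μ = 2 / (((t + 1 : ℕ) : ℝ) + 1) := by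
    rw [γ_def]
    field_simp
  have e2 : 2 * γ ^ 2 * (M i ^ 2 + (μ * Metric.diam (G.X i)) ^ 2) =
      G.Q M μ i / (((t + 1 : ℕ) : ℝ) + 1) ^ 2 := by
    rw [γ_def, Q]
    field_simp
  rw [e1, e2, Pi.sub_apply]

theorem Regular.integrable_inner_sub_sq (hG : G.Regular M) (hμ : 0 < μ)
    (hx₀ : ∀ ω, x₀ ω ∈ G.feasible) (hS : G.Sampling M μ η x₀ S) (i : Fin N) (k t : ℕ) :
    Integrable (fun ω => ‖G.inner μ i (G.iter M μ η x₀ S k ω) (fun l => S i k l ω) t -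
        G.proxBR μ i (G.iter M μ η x₀ S k ω)‖ ^ 2) G.P := by
  have := hG.prob
  have h1 := (hG.measurable_inner_sigmaFin (M := M) (μ := μ) (η := η) (S := S) hx₀ i k t).mono
    (sigmaFin_le hS.meas_x₀ hS.meas_S i k t) le_rfl
  have h2 := (hG.measurable_proxBR_sigmaF (M := M) (η := η) (S := S) hμ hx₀ i k).mono
    (sigmaF_le hS.meas_x₀ hS.meas_S k) le_rfl
  refine Integrable.of_bound ((h1.sub h2).norm.pow_const 2).aestronglyMeasurable
    (Metric.diam (G.X i) ^ 2) (ae_of_all _ fun ω => ?_)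
  rw [Real.norm_of_nonneg (by positivity)]
  exact pow_le_pow_left₀ (norm_nonneg _) (hG.norm_sub_le_diam
    (hG.inner_mem μ i (hG.iter_mem hx₀ k ω) _ _) (hG.proxBR_mem μ i (hG.iter_mem hx₀ k ω))) 2

/-- The rate of the projected stochastic gradient method on the proximal problem. -/
theorem Regular.condExp_inner_le (hG : G.Regular M) (hμ : 0 < μ)
    (hx₀ : ∀ ω, x₀ ω ∈ G.feasible) (hS : G.Sampling M μ η x₀ S) (i : Fin N) (k t : ℕ)
    (ht : t + 1 ≤ G.innerSteps M μ η i k) :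
    G.P[fun ω => ‖G.inner μ i (G.iter M μ η x₀ S k ω) (fun l => S i k l ω) (t + 1) -
        G.proxBR μ i (G.iter M μ η x₀ S k ω)‖ ^ 2 | G.sigmaF M μ η x₀ S k]
      ≤ᵐ[G.P] fun _ => G.Q M μ i / ((t + 1 : ℕ) : ℝ) := by
  have := hG.prob
  have hF : G.sigmaF M μ η x₀ S k ≤ ‹MeasurableSpace Ω› := sigmaF_le hS.meas_x₀ hS.meas_S k
  have hQ := hG.Q_pos hμ i
  have hint := hG.integrable_inner_sub_sq hμ hx₀ hS i k
  induction t with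
  | zero =>
    -- At the starting point the squared error is at most `diam²`, and the term `2 diam²` of `Q`
    -- covers it.
    have hle : ∀ ω, ‖G.inner μ i (G.iter M μ η x₀ S k ω) (fun l => S i k l ω) (0 + 1) -
        G.proxBR μ i (G.iter M μ η x₀ S k ω)‖ ^ 2 ≤ G.Q M μ i / ((0 + 1 : ℕ) : ℝ) := fun ω => by
      have hx := hG.iter_mem (M := M) (μ := μ) (η := η) (S := S) hx₀ k ω
      have h1 := pow_le_pow_left₀ (norm_nonneg _) (hG.norm_sub_le_diam
        (hG.inner_mem μ i hx (fun l => S i k l ω) (0 + 1)) (hG.proxBR_mem μ i hx)) 2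
      refine h1.trans ?_
      have h2 : 0 ≤ 2 * M i ^ 2 / μ ^ 2 := by positivity
      simp only [Q, Nat.zero_add, Nat.cast_one, div_one]
      nlinarith [sq_nonneg (Metric.diam (G.X i))]
    have h := condExp_mono (m := G.sigmaF M μ η x₀ S k) (hint (0 + 1))
      (integrable_const (G.Q M μ i / ((0 + 1 : ℕ) : ℝ))) (ae_of_all _ hle)
    rwa [condExp_const hF] at h
  | succ t ih =>
    have hm : G.sigmaFin M μ η x₀ S i k (t + 1) ≤ ‹MeasurableSpace Ω› :=
      sigmaFin_le hS.meas_x₀ hS.meas_S i k (t + 1)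
    have hstep := hG.condExp_inner_succ_le hμ hx₀ hS i k t
      (Finset.mem_Icc.2 ⟨by omega, by omega⟩)
    -- Tower property: the one-step bound given the inner past is averaged down to `sigmaF`.
    have h1 := condExp_condExp_of_le (μ := G.P)
      (f := fun ω => ‖G.inner μ i (G.iter M μ η x₀ S k ω) (fun l => S i k l ω) (t + 2) -
        G.proxBR μ i (G.iter M μ η x₀ S k ω)‖ ^ 2) (sigmaF_le_sigmaFin i k (t + 1)) hm
    have hi1 := (hint (t + 1)).smul (1 - 2 / (((t + 1 : ℕ) : ℝ) + 1))
    have hi2 : Integrable (fun _ : Ω => G.Q M μ i / (((t + 1 : ℕ) : ℝ) + 1) ^ 2) G.P :=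
      integrable_const _
    have h2 := condExp_mono (m := G.sigmaF M μ η x₀ S k) integrable_condExp (hi1.add hi2) hstep
    filter_upwards [h1, h2, ih (by omega), condExp_add hi1 hi2 (G.sigmaF M μ η x₀ S k),
      condExp_smul (μ := G.P) (1 - 2 / (((t + 1 : ℕ) : ℝ) + 1))
        (fun ω => ‖G.inner μ i (G.iter M μ η x₀ S k ω) (fun l => S i k l ω) (t + 1) -
        G.proxBR μ i (G.iter M μ η x₀ S k ω)‖ ^ 2) (G.sigmaF M μ η x₀ S k)]
      with ω k1 k2 k3 k4 k5
    rw [k1, k4, Pi.add_apply, k5, condExp_const hF] at k2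
    have h3 := sgd_recursion hQ.le (Nat.succ_pos t) k3
    refine k2.trans (h3.trans_eq ?_)
    push_cast
    ring

/-- The scheme computes inexact proximal best responses of accuracy `η ^ (k + 1)`. -/
theorem Regular.condExp_iter_sub_proxBR_le (hG : G.Regular M) (hμ : 0 < μ) (hη : 0 < η)
    (hx₀ : ∀ ω, x₀ ω ∈ G.feasible) (hS : G.Sampling M μ η x₀ S) (i : Fin N) (k : ℕ) :
    G.P[fun ω => ‖G.iter M μ η x₀ S (k + 1) ω i -
        G.proxBR μ i (G.iter M μ η x₀ S k ω)‖ ^ 2 | G.sigmaF M μ η x₀ S k]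
      ≤ᵐ[G.P] fun _ => (η ^ (k + 1)) ^ 2 := by
  have hQ := hG.Q_pos hμ i
  -- `Q > 0` forces `j_{i,k} ≥ 1`, so the dummy inner iterate at index 0 is never returned.
  have hpos : 0 < G.innerSteps M μ η i k := Nat.ceil_pos.2 (by positivity)
  obtain ⟨t, ht⟩ := Nat.exists_eq_succ_of_ne_zero hpos.ne'
  have h := hG.condExp_inner_le hμ hx₀ hS i k t ht.ge
  have hle : G.Q M μ i / ((t + 1 : ℕ) : ℝ) ≤ (η ^ (k + 1)) ^ 2 := by
    have h1 : G.Q M μ i / η ^ (2 * (k + 1)) ≤ ((t + 1 : ℕ) : ℝ) := by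
      have e : t + 1 = G.innerSteps M μ η i k := ht.symm
      rw [e]
      exact Nat.le_ceil _
    rw [← pow_mul, mul_comm (k + 1)]
    rw [div_le_iff₀ (by positivity)] at h1
    rw [div_le_iff₀ (by positivity), mul_comm]
    exact h1
  filter_upwards [h] with ω hω
  refine le_trans (le_of_eq ?_) (hω.trans hle)
  simp only [iter, outer, ht]

end Game

end SNash

end

/-! ### Elementary estimates for the complexity bound. -/

noncomputable section

namespace SNash

section Estimates

theorem Dconst_eq {c q : ℝ} (hc : 0 < c) (hq : 0 < q) :
    Dconst c q = 1 / (Real.exp 1 * (Real.log q - Real.log c)) := by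
  rw [Dconst, Real.log_rpow (by positivity), Real.log_div hq.ne' hc.ne']

theorem Dconst_pos {c q : ℝ} (hc : 0 < c) (hcq : c < q) : 0 < Dconst c q := by
  rw [Dconst_eq hc (hc.trans hcq)]
  have := sub_pos.2 (Real.log_lt_log hc hcq)
  positivity

/-- With `L = ln(q/c)`, the inequality `s + 1 ≤ exp s` at `s = k L - 1` reads `e k L ≤ (q/c)^k`;
hence the `e` in `D`. -/
theorem natCast_mul_pow_le {c q : ℝ} (hc : 0 < c) (hcq : c < q) (k : ℕ) :
    k * c ^ k ≤ Dconst c q * q ^ k := by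
  have hq := hc.trans hcq
  have hl := sub_pos.2 (Real.log_lt_log hc hcq)
  rw [Dconst_eq hc hq, one_div_mul_eq_div, le_div_iff₀ (by positivity)]
  have h1 := Real.add_one_le_exp (k * (Real.log q - Real.log c) - 1)
  have h2 : Real.exp (k * (Real.log q - Real.log c) - 1) * Real.exp 1 = q ^ k / c ^ k := by
    rw [← Real.exp_add, sub_add_cancel, mul_sub, Real.exp_sub, Real.exp_nat_mul,
      Real.exp_nat_mul, Real.exp_log hq, Real.exp_log hc]
  rw [sub_add_cancel] at h1
  have h3 := mul_le_mul_of_nonneg_right h1 (Real.exp_pos 1).le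
  rw [h2, le_div_iff₀ (by positivity)] at h3
  linarith

theorem log_one_div_pos {q : ℝ} (hq0 : 0 < q) (hq1 : q < 1) : 0 < Real.log (1 / q) :=
  Real.log_pos (by rwa [lt_div_iff₀ hq0, one_mul])

theorem pow_ceil_mul_le_one {q R : ℝ} (hq0 : 0 < q) (hq1 : q < 1) (hR : 0 < R) :
    q ^ ⌈Real.log R / Real.log (1 / q)⌉₊ * R ≤ 1 := by
  have h1 := Nat.le_ceil (Real.log R / Real.log (1 / q))
  rw [div_le_iff₀ (log_one_div_pos hq0 hq1), one_div, Real.log_inv] at h1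
  rw [one_div, Real.log_inv]
  rw [← Real.log_nonpos_iff (by positivity), Real.log_mul (by positivity) hR.ne', Real.log_pow]
  linarith

/-- As `log b ≤ b - 1`, each term times `log b` is at most `b^(k+2) - b^(k+1)`, and the sum
telescopes. -/
theorem sum_pow_succ_le {b : ℝ} (hb : 1 < b) (K : ℕ) :
    ∑ k ∈ Finset.range K, b ^ (k + 1) ≤ b ^ (K + 1) / Real.log b := by
  have hl := Real.log_pos hb
  have h1 : Real.log b ≤ b - 1 := Real.log_le_sub_one_of_pos (by linarith)
  rw [le_div_iff₀ hl]
  induction K with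
  | zero => simp; linarith
  | succ K ih =>
    rw [Finset.sum_range_succ, add_mul]
    have h2 : b ^ (K + 1) * Real.log b ≤ b ^ (K + 1) * (b - 1) := by gcongr
    rw [pow_succ b (K + 1)]
    linarith

/-- Each rounding costs at most 1, which produces the additive `⌈s⌉`. Since `⌈s⌉ < s + 1`, the
geometric sum is governed by `b^(s+2)`, where `b² = η⁻⁴` and `b^s` is the power of `R`. -/
theorem sum_ceil_le {Q η q R : ℝ} (hQ : 0 ≤ Q) (hη0 : 0 < η) (hη1 : η < 1) (hq0 : 0 < q)
    (hq1 : q < 1) (hR : 0 < R) :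
    ((∑ k ∈ Finset.range ⌈Real.log R / Real.log (1 / q)⌉₊, ⌈Q / η ^ (2 * (k + 1))⌉₊ : ℕ) : ℝ) ≤
      Q / (η ^ 4 * Real.log (1 / η ^ 2)) * R ^ (Real.log (1 / η ^ 2) / Real.log (1 / q)) +
        (⌈Real.log R / Real.log (1 / q)⌉₊ : ℝ) := by
  set s := Real.log R / Real.log (1 / q) with s_def
  set b := 1 / η ^ 2 with b_def
  have hb : 1 < b := by
    rw [b_def, lt_div_iff₀ (by positivity), one_mul]
    exact pow_lt_one₀ hη0.le hη1 two_ne_zero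
  have hl := Real.log_pos hb
  have hlq := log_one_div_pos hq0 hq1
  rcases Nat.eq_zero_or_pos ⌈s⌉₊ with h0 | h0
  · rw [h0]
    simp only [Finset.range_zero, Finset.sum_empty, Nat.cast_zero, add_zero]
    positivity
  have hs : 0 < s := Nat.ceil_pos.1 h0
  have hK := Nat.ceil_lt_add_one hs.le
  have h1 : ∀ k ∈ Finset.range ⌈s⌉₊, ((⌈Q / η ^ (2 * (k + 1))⌉₊ : ℕ) : ℝ) ≤
      Q * b ^ (k + 1) + 1 := fun k _ => by
    have e : Q / η ^ (2 * (k + 1)) = Q * b ^ (k + 1) := by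
      rw [b_def, one_div, inv_pow, ← pow_mul]
      rfl
    rw [e]
    exact (Nat.ceil_lt_add_one (by positivity)).le
  push_cast
  refine (Finset.sum_le_sum h1).trans ?_
  rw [Finset.sum_add_distrib, ← Finset.mul_sum, Finset.sum_const, Finset.card_range, nsmul_one]
  refine add_le_add_left ((mul_le_mul_of_nonneg_left (sum_pow_succ_le hb _) hQ).trans ?_) _
  have h2 : b ^ (⌈s⌉₊ + 1) ≤ 1 / η ^ 4 * R ^ (Real.log b / Real.log (1 / q)) := by
    have e1 : R ^ (Real.log b / Real.log (1 / q)) = b ^ s := by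
      rw [Real.rpow_def_of_pos hR, Real.rpow_def_of_pos (by linarith), s_def]
      congr 1
      ring
    have e2 : 1 / η ^ 4 = b ^ (2 : ℝ) := by
      rw [b_def, Real.rpow_two]
      field_simp
    rw [e1, e2, ← Real.rpow_add (by linarith), ← Real.rpow_natCast]
    refine Real.rpow_le_rpow_of_exponent_le hb.le ?_
    push_cast
    linarith
  calc Q * (b ^ (⌈s⌉₊ + 1) / Real.log b)
      ≤ Q * ((1 / η ^ 4 * R ^ (Real.log b / Real.log (1 / q))) / Real.log b) := by gcongr
    _ = _ := by field_simp

/-- The complexity bound is at least of order `ε⁻²`. -/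
theorem inv_sq_isBigO_ell {Q η q C D : ℝ} {N : ℕ} (hQ : 0 < Q) (hη0 : 0 < η) (hηq : η < q)
    (hq1 : q < 1) (hN : 0 < N) (hCD : 0 < C + D) :
    (fun ε : ℝ => 1 / ε ^ 2) =O[𝓝[>] 0] fun ε : ℝ => ell Q η N C D q ε := by
  have hq0 := hη0.trans hηq
  have hlη := log_one_div_pos hη0 (hηq.trans hq1)
  have hlq := log_one_div_pos hq0 hq1
  have e2 : Real.log (1 / η ^ 2) = 2 * Real.log (1 / η) := by
    rw [one_div, one_div, ← inv_pow, Real.log_pow]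
    norm_num
  set p := Real.log (1 / η ^ 2) / Real.log (1 / q) with p_def
  -- `η < q` makes the exponent at least 2, hence `ε^p ≤ ε²` for `ε < 1`.
  have hp : 2 ≤ p := by
    rw [p_def, le_div_iff₀ hlq, e2]
    have : Real.log (1 / q) ≤ Real.log (1 / η) :=
      Real.log_le_log (by positivity) (one_div_le_one_div_of_le hη0 hηq.le)
    linarith
  set A := Q / (η ^ 4 * Real.log (1 / η ^ 2)) with A_def
  have hA : 0 < A := by
    rw [A_def, e2]
    positivity
  have hN' : (0 : ℝ) < N := by exact_mod_cast hN
  have hR : 0 < √N * (C + D) := by positivity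
  refine Asymptotics.IsBigO.of_bound (1 / (A * (√N * (C + D)) ^ p)) ?_
  filter_upwards [Ioo_mem_nhdsGT (zero_lt_one' ℝ)] with ε hε
  have hε0 : 0 < ε := hε.1
  have h1 : A * (√N * (C + D)) ^ p * (1 / ε ^ 2) ≤ ell Q η N C D q ε := by
    rw [ell, Real.div_rpow hR.le hε0.le]
    have h2 : ε ^ p ≤ ε ^ 2 := by
      rw [← Real.rpow_two]
      exact Real.rpow_le_rpow_of_exponent_ge hε0 hε.2.le hp
    have h3 : 1 / ε ^ 2 ≤ 1 / ε ^ p := one_div_le_one_div_of_le (by positivity) h2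
    calc A * (√N * (C + D)) ^ p * (1 / ε ^ 2) ≤ A * (√N * (C + D)) ^ p * (1 / ε ^ p) := by gcongr
      _ = A * ((√N * (C + D)) ^ p / ε ^ p) := by ring
      _ ≤ _ := le_add_of_nonneg_right (Nat.cast_nonneg _)
  rw [Real.norm_of_nonneg (by positivity), one_div_mul_eq_div, le_div_iff₀ (by positivity),
    mul_comm]
  exact h1.trans (le_abs_self _)

/-- A choice of `q` for which the exponent in the complexity bound is `2 + δ`. -/
theorem exists_rate {a δ : ℝ} (ha0 : 0 < a) (ha1 : a < 1) (hδ : 0 < δ) :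
    ∃ q : ℝ, a < q ∧ q < 1 ∧
      Dconst a q = (1 + 2 * δ⁻¹) / (Real.exp 1 * Real.log a⁻¹) ∧
      Real.log (1 / a ^ 2) / Real.log (1 / q) = 2 + δ ∧
      1 / Real.log (1 / q) = (2 + δ) / (2 * Real.log a⁻¹) := by
  have hL : 0 < Real.log a⁻¹ := Real.log_pos ((one_lt_inv₀ ha0).2 ha1)
  have hla : Real.log a = -Real.log a⁻¹ := by rw [Real.log_inv, neg_neg]
  have hlq : Real.log (a ^ (2 / (2 + δ))) = -(2 / (2 + δ) * Real.log a⁻¹) := by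
    rw [Real.log_rpow ha0, hla, mul_neg]
  have hlt : 2 / (2 + δ) < 1 := by
    rw [div_lt_one (by positivity)]
    linarith
  have hq0 : 0 < a ^ (2 / (2 + δ)) := by positivity
  -- This `q` solves `2 ln(1/a) / ln(1/q) = 2 + δ`; then `ln(q/a) = δ/(2+δ) · ln(1/a)`, which yields
  -- `D`.
  refine ⟨a ^ (2 / (2 + δ)), ?_, Real.rpow_lt_one ha0.le ha1 (by positivity), ?_, ?_, ?_⟩
  · simpa using Real.rpow_lt_rpow_of_exponent_gt ha0 ha1 hlt
  · rw [Dconst_eq ha0 hq0, hlq, hla]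
    have e : -(2 / (2 + δ) * Real.log a⁻¹) - -Real.log a⁻¹ = δ / (2 + δ) * Real.log a⁻¹ := by
      field_simp
      ring
    rw [e]
    generalize Real.log a⁻¹ = L at hL ⊢
    field_simp
    ring
  · rw [one_div, one_div, Real.log_inv, Real.log_inv (a ^ (2 / (2 + δ))), hlq, Real.log_pow, hla]
    generalize Real.log a⁻¹ = L at hL ⊢
    push_cast
    field_simp
  · rw [one_div (a ^ _), Real.log_inv, hlq, neg_neg]
    field_simp

/-- The complexity bound is of the order of `(√N / ε) ^ p`. -/
theorem exists_ell_le {Q η q C D p : ℝ}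
    (hq0 : 0 < q) (hq1 : q < 1) (hCD : 0 < C + D)
    (hp : Real.log (1 / η ^ 2) / Real.log (1 / q) = p) (hp1 : 1 ≤ p) :
    ∃ B : ℝ, ∀ N : ℕ, 1 ≤ N → ∀ ε : ℝ, 0 < ε → ε ≤ 1 →
      ell Q η N C D q ε ≤ B * (√N / ε) ^ p := by
  have hlq := log_one_div_pos hq0 hq1
  refine ⟨Q / (η ^ 4 * Real.log (1 / η ^ 2)) * (C + D) ^ p +
    ((C + D) / Real.log (1 / q) + 1), fun N hN ε hε0 hε1 => ?_⟩
  -- `r ≥ 1` lets `r ^ p` absorb both the logarithm and the 1 lost in rounding.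
  have hr : 1 ≤ √N / ε := by
    rw [le_div_iff₀ hε0, one_mul]
    exact hε1.trans (Real.one_le_sqrt.2 (by exact_mod_cast hN))
  have e : √N * (C + D) / ε = (C + D) * (√N / ε) := by ring
  rw [ell, hp, e, Real.mul_rpow hCD.le (by positivity)]
  set r := √N / ε
  have hrp : r ≤ r ^ p := by simpa using Real.rpow_le_rpow_of_exponent_le hr hp1
  have h1 : (⌈Real.log ((C + D) * r) / Real.log (1 / q)⌉₊ : ℝ) ≤
      ((C + D) / Real.log (1 / q) + 1) * r ^ p := by
    have h2 : Real.log ((C + D) * r) / Real.log (1 / q) ≤ (C + D) * r / Real.log (1 / q) := by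
      gcongr
      exact Real.log_le_self (by positivity)
    have h3 : (⌈Real.log ((C + D) * r) / Real.log (1 / q)⌉₊ : ℝ) ≤
        (⌈(C + D) * r / Real.log (1 / q)⌉₊ : ℝ) := by exact_mod_cast Nat.ceil_mono h2
    have h4 := Nat.ceil_lt_add_one (a := (C + D) * r / Real.log (1 / q)) (by positivity)
    calc (⌈Real.log ((C + D) * r) / Real.log (1 / q)⌉₊ : ℝ)
        ≤ (C + D) * r / Real.log (1 / q) + 1 := h3.trans h4.le
      _ ≤ (C + D) * r / Real.log (1 / q) + r := by gcongr
      _ = ((C + D) / Real.log (1 / q) + 1) * r := by ring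
      _ ≤ _ := by gcongr
  linarith

end Estimates

/-! ### Mean distance of the iterates from the equilibrium. -/

namespace Game

variable {N d : ℕ} {n : Fin N → ℕ} {Ω : Type*} [MeasurableSpace Ω] {G : Game N d n Ω}
  {M : Fin N → ℝ} {μ η : ℝ} {x₀ : Ω → Profile n} {S : Fin N → ℕ → ℕ → Ω → Noise d}
  {xs : Profile n}

theorem measurable_pdist {x y : Ω → Profile n} (hx : Measurable x) (hy : Measurable y) :
    Measurable fun ω => pdist (x ω) (y ω) :=
  (Finset.measurable_sum _ fun i _ => ((((measurable_pi_apply i).comp hx).sub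
    ((measurable_pi_apply i).comp hy)).norm.pow_const 2)).sqrt

theorem Regular.integrable_pdist (hG : G.Regular M) {x y : Ω → Profile n} (hx : Measurable x)
    (hy : Measurable y) (hxf : ∀ ω, x ω ∈ G.feasible) (hyf : ∀ ω, y ω ∈ G.feasible) :
    Integrable (fun ω => pdist (x ω) (y ω)) G.P := by
  have := hG.prob
  refine Integrable.of_bound (measurable_pdist hx hy).aestronglyMeasurable
    (√(∑ i, Metric.diam (G.X i) ^ 2)) (ae_of_all _ fun ω => ?_)
  rw [Real.norm_of_nonneg (pdist_nonneg _ _)]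
  exact Real.sqrt_le_sqrt (Finset.sum_le_sum fun i _ =>
    pow_le_pow_left₀ (norm_nonneg _) (hG.norm_sub_le_diam (hxf ω i) (hyf ω i)) 2)

theorem Regular.measurable_iter (hG : G.Regular M) (hx₀ : ∀ ω, x₀ ω ∈ G.feasible)
    (hS : G.Sampling M μ η x₀ S) (k : ℕ) : Measurable (G.iter M μ η x₀ S k) :=
  (hG.measurable_iter_sigmaF hx₀ k).mono (sigmaF_le hS.meas_x₀ hS.meas_S k) le_rfl

theorem Regular.measurable_proxBR_iter (hG : G.Regular M) (hμ : 0 < μ)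
    (hx₀ : ∀ ω, x₀ ω ∈ G.feasible) (hS : G.Sampling M μ η x₀ S) (k : ℕ) :
    Measurable fun ω i => G.proxBR μ i (G.iter M μ η x₀ S k ω) :=
  measurable_pi_lambda _ fun i => (hG.measurable_proxBR_sigmaF hμ hx₀ i k).mono
    (sigmaF_le hS.meas_x₀ hS.meas_S k) le_rfl

/-- The mean distance between the new iterate and the exact proximal best response. -/
theorem Regular.integral_pdist_iter_proxBR_le (hG : G.Regular M) (hμ : 0 < μ) (hη : 0 < η)
    (hx₀ : ∀ ω, x₀ ω ∈ G.feasible) (hS : G.Sampling M μ η x₀ S) (k : ℕ) :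
    ∫ ω, pdist (G.iter M μ η x₀ S (k + 1) ω)
      (fun i => G.proxBR μ i (G.iter M μ η x₀ S k ω)) ∂G.P ≤ √N * η ^ (k + 1) := by
  have := hG.prob
  rcases Nat.eq_zero_or_pos N with rfl | hN
  · simp [pdist]
  have hN' : (0 : ℝ) < N := by exact_mod_cast hN
  have hm := sigmaF_le (G := G) (M := M) (μ := μ) (η := η) hS.meas_x₀ hS.meas_S k
  have hix := hG.measurable_iter hx₀ hS (k + 1)
  have hip := hG.measurable_proxBR_iter hμ hx₀ hS k
  have hi := hG.integrable_pdist hix hip (hG.iter_mem hx₀ (k + 1))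
    fun ω i => hG.proxBR_mem μ i (hG.iter_mem hx₀ k ω)
  have hsq : ∀ i, Integrable (fun ω => ‖G.iter M μ η x₀ S (k + 1) ω i -
      G.proxBR μ i (G.iter M μ η x₀ S k ω)‖ ^ 2) G.P := fun i =>
    hG.integrable_inner_sub_sq hμ hx₀ hS i k (G.innerSteps M μ η i k)
  have hle : ∀ i, ∫ ω, ‖G.iter M μ η x₀ S (k + 1) ω i -
      G.proxBR μ i (G.iter M μ η x₀ S k ω)‖ ^ 2 ∂G.P ≤ (η ^ (k + 1)) ^ 2 := fun i => by
    rw [← integral_condExp hm]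
    refine (integral_mono_ae integrable_condExp (integrable_const _)
      (hG.condExp_iter_sub_proxBR_le hμ hη hx₀ hS i k)).trans_eq ?_
    simp
  set s := √N * η ^ (k + 1) with s_def
  have hs : 0 < s := by positivity
  have hs2 : s ^ 2 = N * (η ^ (k + 1)) ^ 2 := by rw [s_def, mul_pow, Real.sq_sqrt hN'.le]
  -- Instead of Jensen's inequality: `e ≤ e² / (2 s) + s / 2`, with `s²` the bound on the mean of
  -- `e²`, so that the right side averages to at most `s`.
  have hamgm : ∀ ω, pdist (G.iter M μ η x₀ S (k + 1) ω)
      (fun i => G.proxBR μ i (G.iter M μ η x₀ S k ω)) ≤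
      (∑ i, ‖G.iter M μ η x₀ S (k + 1) ω i -
        G.proxBR μ i (G.iter M μ η x₀ S k ω)‖ ^ 2) / (2 * s) + s / 2 := fun ω => by
    have h : pdist (G.iter M μ η x₀ S (k + 1) ω)
        (fun i => G.proxBR μ i (G.iter M μ η x₀ S k ω)) ^ 2 = ∑ i, ‖G.iter M μ η x₀ S (k + 1) ω i -
          G.proxBR μ i (G.iter M μ η x₀ S k ω)‖ ^ 2 :=
      Real.sq_sqrt (Finset.sum_nonneg fun _ _ => sq_nonneg _)
    rw [← h, ← sub_nonneg]
    set e := pdist (G.iter M μ η x₀ S (k + 1) ω)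
      (fun i => G.proxBR μ i (G.iter M μ η x₀ S k ω))
    have : e ^ 2 / (2 * s) + s / 2 - e = (e - s) ^ 2 / (2 * s) := by
      field_simp
      ring
    rw [this]
    positivity
  have hsum := integrable_finsetSum Finset.univ fun i _ => hsq i
  refine (integral_mono hi ((hsum.div_const (2 * s)).add (integrable_const (s / 2))) hamgm).trans ?_
  rw [integral_add' (hsum.div_const (2 * s)) (integrable_const (s / 2)), integral_div,
    integral_finsetSum _ fun i _ => hsq i]
  have h1 : ∑ i, ∫ ω, ‖G.iter M μ η x₀ S (k + 1) ω i -
      G.proxBR μ i (G.iter M μ η x₀ S k ω)‖ ^ 2 ∂G.P ≤ s ^ 2 := by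
    rw [hs2]
    refine (Finset.sum_le_sum fun i _ => hle i).trans_eq ?_
    simp
  have h2 : s ^ 2 / (2 * s) + s / 2 = s := by
    field_simp
    ring
  calc _ ≤ s ^ 2 / (2 * s) + s / 2 := by
        gcongr
        simp
    _ = s := h2

theorem Regular.integral_pdist_succ_le (hG : G.Regular M) (hμ : 0 < μ) (hη : 0 < η)
    (hxs : G.IsNash xs) (hx₀ : ∀ ω, x₀ ω ∈ G.feasible) (hS : G.Sampling M μ η x₀ S) (k : ℕ) :
    ∫ ω, pdist (G.iter M μ η x₀ S (k + 1) ω) xs ∂G.P ≤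
      √N * η ^ (k + 1) + G.a μ * ∫ ω, pdist (G.iter M μ η x₀ S k ω) xs ∂G.P := by
  have hxf := hG.iter_mem (M := M) (μ := μ) (η := η) (S := S) hx₀
  have hix := hG.measurable_iter hx₀ hS
  have hi := fun k => hG.integrable_pdist (hix k) measurable_const (hxf k) fun _ => hxs.1
  have hie := hG.integrable_pdist (hix (k + 1)) (hG.measurable_proxBR_iter hμ hx₀ hS k)
    (hxf (k + 1)) fun ω i => hG.proxBR_mem μ i (hxf k ω)
  have h := integral_mono (hi (k + 1)) (hie.add ((hi k).const_mul (G.a μ))) fun ω =>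
    (pdist_triangle _ _ _).trans (add_le_add_right (hG.pdist_proxBR_le hμ hxs (hxf k ω)) _)
  refine h.trans ?_
  rw [integral_add' hie ((hi k).const_mul (G.a μ)), integral_const_mul]
  exact add_le_add_left (hG.integral_pdist_iter_proxBR_le hμ hη hx₀ hS k) _

/-- The mean distance of the iterates from the equilibrium. -/
theorem Regular.integral_pdist_iter_le (hG : G.Regular M) (hμ : 0 < μ) (hη : 0 < η)
    (hxs : G.IsNash xs) (hx₀ : ∀ ω, x₀ ω ∈ G.feasible) (hS : G.Sampling M μ η x₀ S) {C : ℝ}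
    (hC : ∫ ω, pdist (x₀ ω) xs ∂G.P ≤ √N * C) {c : ℝ} (hac : G.a μ ≤ c) (hηc : η ≤ c) (k : ℕ) :
    ∫ ω, pdist (G.iter M μ η x₀ S k ω) xs ∂G.P ≤ √N * (c ^ k * (C + k)) := by
  have hc : 0 < c := hη.trans_le hηc
  induction k with
  | zero => simpa [iter, outer] using hC
  | succ k ih =>
    have hnn : 0 ≤ ∫ ω, pdist (G.iter M μ η x₀ S k ω) xs ∂G.P :=
      integral_nonneg fun _ => pdist_nonneg _ _
    calc _ ≤ _ := hG.integral_pdist_succ_le hμ hη hxs hx₀ hS k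
      -- With `a` and `η` both replaced by `c`, every iteration adds one more `√N c^(k+1)`; this is
      -- the source of the factor `k`.
      _ ≤ √N * c ^ (k + 1) + c * (√N * (c ^ k * (C + k))) := by gcongr
      _ = _ := by
        push_cast
        ring

end Game

end SNash

end

/-! ### The theorem. -/

theorem theorem1 {N d : ℕ} {n : Fin N → ℕ} {Ω : Type*} [MeasurableSpace Ω]
    (G : SNash.Game N d n Ω) (M : Fin N → ℝ) (hG : G.Regular M)
    (μ : ℝ) (hμ : 0 < μ) (ha : G.a μ < 1)
    (xs : SNash.Profile n) (hxs : G.IsNash xs)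
    (η : ℝ) (hη0 : 0 < η) (hη1 : η < 1)
    (x₀ : Ω → SNash.Profile n) (hx₀ : ∀ ω, x₀ ω ∈ G.feasible)
    (S : Fin N → ℕ → ℕ → Ω → SNash.Noise d) (hS : G.Sampling M μ η x₀ S)
    (C : ℝ) (hC : ∫ ω, SNash.pdist (x₀ ω) xs ∂G.P ≤ √N * C) :
    -- the scheme computes inexact proximal best responses of accuracy `α_{i,k} = η^{k+1}`
    (∀ i k, (∀ ω, G.iter M μ η x₀ S (k + 1) ω i ∈ G.X i) ∧
      G.P[fun ω => ‖G.iter M μ η x₀ S (k + 1) ω i -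
            G.proxBR μ i (G.iter M μ η x₀ S k ω)‖ ^ 2 | G.sigmaF M μ η x₀ S k]
        ≤ᵐ[G.P] fun _ => (η ^ (k + 1)) ^ 2) ∧
    -- (a) overall iteration complexity
    (∀ q : ℝ, max (G.a μ) η < q → q < 1 → ∀ ε : ℝ, 0 < ε →
      ∃ K : ℕ, G.IsEpsNE2 xs ε (G.iter M μ η x₀ S K) ∧
        ∀ i, ((∑ k ∈ Finset.range K, G.innerSteps M μ η i k : ℕ) : ℝ) ≤
          SNash.ell (G.Q M μ i) η N C (SNash.Dconst (max (G.a μ) η) q) q ε) ∧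
    -- (b) lower bound on the expression `ℓ_i(η)`
    (∀ q : ℝ, max (G.a μ) η < q → q < 1 → ∀ i,
      (fun ε : ℝ => 1 / ε ^ 2) =O[𝓝[>] 0] fun ε : ℝ =>
        SNash.ell (G.Q M μ i) η N C (SNash.Dconst (max (G.a μ) η) q) q ε) ∧
    -- (b) upper bound on `ℓ_i(a)`
    (∀ δ : ℝ, 0 < δ → ∀ i, ∃ q D : ℝ, G.a μ < q ∧ q < 1 ∧
      D = SNash.Dconst (G.a μ) q ∧
      D = (1 + 2 * δ⁻¹) / (Real.exp 1 * Real.log (G.a μ)⁻¹) ∧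
      (∀ ε : ℝ, 0 < ε →
        SNash.ell (G.Q M μ i) (G.a μ) N C D q ε ≤
          G.Q M μ i / (G.a μ ^ 4 * Real.log (1 / G.a μ ^ 2)) *
              (√N * (C + D) / ε) ^ (2 + δ) +
            (⌈Real.log (√N * (C + D) / ε) *
              ((2 + δ) / (2 * Real.log (G.a μ)⁻¹))⌉₊ : ℝ)) ∧
      ∃ B : ℝ, ∀ N' : ℕ, 1 ≤ N' → ∀ ε : ℝ, 0 < ε → ε ≤ 1 →
        SNash.ell (G.Q M μ i) (G.a μ) N' C D q ε ≤ B * (√N' / ε) ^ (2 + δ)) := by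
  have hrate : ∀ {q : ℝ}, max (G.a μ) η < q → 0 < max (G.a μ) η ∧ 0 < q := fun hq =>
    ⟨hη0.trans_le (le_max_right _ _), hη0.trans (max_lt_iff.1 hq).2⟩
  -- The sign of `C` follows from the bound on a nonnegative mean, but only if there is a player;
  -- for `N = 0` all distances vanish.
  have hC0 : 0 < N → 0 ≤ C := fun hN => by
    have h1 : 0 < √(N : ℝ) := Real.sqrt_pos.2 (by exact_mod_cast hN)
    exact nonneg_of_mul_nonneg_right
      ((integral_nonneg fun _ => SNash.pdist_nonneg _ _).trans hC) h1
  refine ⟨fun i k => ⟨fun ω => hG.iter_mem hx₀ (k + 1) ω i,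
    hG.condExp_iter_sub_proxBR_le hμ hη0 hx₀ hS i k⟩, fun q hq hq1 ε hε => ?_,
    fun q hq hq1 i => ?_, fun δ hδ i => ?_⟩
  · obtain ⟨hc0, hq0⟩ := hrate hq
    set c := max (G.a μ) η with c_def
    set D := SNash.Dconst c q with D_def
    have hD : 0 < D := SNash.Dconst_pos hc0 hq
    set K := ⌈Real.log (√N * (C + D) / ε) / Real.log (1 / q)⌉₊ with K_def
    have hR : 0 < N → 0 < √N * (C + D) / ε := fun hN => by
      have h1 : 0 < √(N : ℝ) := Real.sqrt_pos.2 (by exact_mod_cast hN)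
      have := hC0 hN
      positivity
    have hu := hG.integral_pdist_iter_le hμ hη0 hxs hx₀ hS hC (le_max_left _ η)
      (le_max_right (G.a μ) _) K
    refine ⟨K, ⟨hG.integrable_pdist (hG.measurable_iter hx₀ hS K) measurable_const
      (hG.iter_mem hx₀ K) fun _ => hxs.1, hu.trans ?_⟩, fun i => ?_⟩
    · rcases Nat.eq_zero_or_pos N with hN | hN
      · have : √(N : ℝ) = 0 := by simp [hN]
        rw [this, zero_mul]
        exact hε.le
      · have h1 := SNash.pow_ceil_mul_le_one hq0 hq1 (hR hN)
        rw [← K_def, ← mul_div_assoc, div_le_one hε] at h1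
        have h2 := SNash.natCast_mul_pow_le hc0 hq K
        have h3 : c ^ K * C ≤ q ^ K * C :=
          mul_le_mul_of_nonneg_right (pow_le_pow_left₀ hc0.le hq.le K) (hC0 hN)
        calc √N * (c ^ K * (C + K)) ≤ √N * (q ^ K * (C + D)) :=
              mul_le_mul_of_nonneg_left (by linarith) (Real.sqrt_nonneg _)
          _ = q ^ K * (√N * (C + D)) := by ring
          _ ≤ ε := h1
    · exact SNash.sum_ceil_le (hG.Q_pos hμ i).le hη0 hη1 hq0 hq1 (hR i.pos)
  · obtain ⟨hc0, hq0⟩ := hrate hq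
    have hD := SNash.Dconst_pos hc0 hq
    exact SNash.inv_sq_isBigO_ell (hG.Q_pos hμ i) hη0 (max_lt_iff.1 hq).2 hq1 i.pos
      (add_pos_of_nonneg_of_pos (hC0 i.pos) hD)
  · have ha0 := hG.a_pos hμ i
    obtain ⟨q, haq, hq1, hD, hp, hl⟩ := SNash.exists_rate ha0 ha hδ
    refine ⟨q, SNash.Dconst (G.a μ) q, haq, hq1, rfl, hD, fun ε _ => ?_,
      SNash.exists_ell_le (ha0.trans haq) hq1
        (add_pos_of_nonneg_of_pos (hC0 i.pos) (SNash.Dconst_pos ha0 haq)) hp (by linarith)⟩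
    rw [SNash.ell, hp, ← hl, mul_one_div]
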